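/- **Setting.** An instance of the multistage $K$-facility reallocation problem on the line ($K\ge 1$) consists of initial positions $x^0=(x^0_1,\dots,x^0_K)\in\mathbb R^K$ of the facilities and positions $\alpha_i^t\in\mathbb R$ of the agents $i=1,\dots,n$ at the stages $t=1,\dots,T$. A solution $x=(x^1,\dots,x^T)$, $x^t\in\mathbb R^K$, has cost $$\mathrm{Cost}(x)=\sum_{t=1}^T\Big[\sum_{k=1}^K|x_k^t-x_k^{t-1}|+\sum_{i=1}^n\min_{1\le k\le K}|\alpha_i^t-x_k^t|\Big].$$ Let $V$ be the nodes of the path whose $j$-th node is the $j$-th leftmost of the distinct positions $\{x_k^0\}\cup\{\alpha_i^t\}$, with $d(j,l)$ the distance of the corresponding positions, and let $\mathrm{Loc}(i,t)\in V$ be the node at $\alpha_i^t$. The LP relaxation is $$\min \sum_{t=1}^T\Big[\sum_i\sum_{j\in V}d(\mathrm{Loc}(i,t),j)\,x_{ij}^t+\sum_k S_k^t\Big]$$ subject to, for all $t\in\{1,\dots,T\}$, $i$, $k$ and $j,l\in V$: $\sum_{j}x_{ij}^t=1$; $x_{ij}^t\le c_j^t$; $c_j^t=\sum_k f_{kj}^t$;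 $\sum_j f_{kj}^t=1$; $S_k^t=\sum_{j,l}d(j,l)S_{kjl}^t$; $\sum_j S_{kjl}^t=f_{kl}^t$; $\sum_l S_{kjl}^t=f_{kj}^{t-1}$; and $x_{ij}^t,f_{kj}^t,S_{kjl}^t\in[0,1]$, where $f_{kj}^0=1$ if facility $k$ is initially at node $j$, and $f_{kj}^0=0$ otherwise. **Algorithm.** Construct the path and the LP; obtain an optimal LP solution from an exact LP solver; then at each stage $t$, for $m=1,\dots,K$, place the $m$-th facility (facilities numbered from left to right by initial position) at the node $j_m^t$ with $\sum_{\ell<j_m^t}c_\ell^t\le m-1<\sum_{\ell\le j_m^t}c_\ell^t$. **Theorem.** 1. The LP has an optimal solution. For every optimal LP solution the nodes $j_m^t$ exist and are unique, and the rounded solution $x$ satisfies $$\mathrm{Cost}(x)=\sum_{t=1}^T\Big[\sum_i\sum_{j\in V}d(\mathrm{Loc}(i,t),j)\,x_{ij}^t+\sum_k S_k^t\Big],$$ the optimum of the LP; moreover $\mathrm{Cost}(x)\le\mathrm{Cost}(y)$ for every solution $y$ with arbitrary real positions. 2. There is one polynomial $p$ such that for all $n,T$, all $K\ge1$, all instances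 and all exact LP solvers: the algorithm computes the path, an optimal LP solution and its rounding $x$ (so that the conclusions of 1. hold for $x$); its LP has at most $p(n+K+T)$ variables and at most $p(n+K+T)$ constraints; and its number of steps (additions, subtractions, comparisons, assignments) is at most $p(n+K+T)$ plus the time of the one call of the solver on this LP. 3. For the same $p$: if the solver needs at most $\tau(s)$ steps on rational LPs of encoding length $s$, for a polynomial $\tau$, then on every instance with rational positions and encoding length $s$ the algorithm takes at most $p(s)+\tau(p(s))$ steps. So with any polynomial-time LP solver the algorithm runs in polynomial time, for any number $K$ of facilities. -/

import Mathlib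

open Finset

noncomputable section

namespace FacilityReallocation

/-! ### The problem -/

/-- An instance of `K`-facility reallocation on the real line with `n` agents and `T` stages:
the initial positions of the facilities and the position `agent t i` of agent `i` at each stage.
The stages `1, …, T` are indexed by `Fin T`. -/
structure Reallocation (n K T : ℕ) where
  x0 : Fin K → ℝ
  agent : Fin T → Fin n → ℝ

namespace Reallocation

variable {n K T : ℕ}

/-- The cost of the solution `x`, where `x t k` is the position of facility `k` at stage `t`:
the moving cost plus the connection cost. The sequence `Fin.cons I.x0 x` is `x⁰, x¹, …, x^T`. -/
def cost [NeZero K] (I : Reallocation n K T) (x : Fin T → Fin K → ℝ) : ℝ :=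
  ∑ t : Fin T,
    ((∑ k : Fin K,
        |(Fin.cons I.x0 x : Fin (T + 1) → Fin K → ℝ) t.succ k -
          (Fin.cons I.x0 x : Fin (T + 1) → Fin K → ℝ) t.castSucc k|) +
      ∑ i : Fin n, univ.inf' univ_nonempty fun k : Fin K => |I.agent t i - x t k|)

/-- The set of positions at which a facility was initially lying or an agent ever appears. -/
def positions (I : Reallocation n K T) : Set ℝ :=
  Set.range I.x0 ∪ {p | ∃ t i, I.agent t i = p}

end Reallocation

/-! ### The discretized form on a path -/

/-- Data of the discretized problem: a path with nodes `0, …, edges`, the positions of its nodes on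
the line, the node of every agent at every stage and the initial node of every facility. -/
structure Discretized (n K T : ℕ) where
  edges : ℕ
  node : Fin (edges + 1) → ℝ
  loc : Fin T → Fin n → Fin (edges + 1)
  start : Fin K → Fin (edges + 1)

namespace Discretized

variable {n K T : ℕ}

/-- The nodes of the path. -/
abbrev V (D : Discretized n K T) : Type := Fin (D.edges + 1)

/-- The distance of two nodes in the path. -/
def d (D : Discretized n K T) (j l : D.V) : ℝ := |D.node j - D.node l|

/-- `D` is the discretized form of `I`: the `j`-th node is the `j`-th leftmost position, and
agents and facilities sit at the nodes of their positions. -/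
structure IsDiscretizationOf (D : Discretized n K T) (I : Reallocation n K T) : Prop where
  strictMono : StrictMono D.node
  range_eq : Set.range D.node = I.positions
  loc_eq : ∀ t i, D.node (D.loc t i) = I.agent t i
  start_eq : ∀ k, D.node (D.start k) = I.x0 k

/-- The constants `f_{kj}^0`. -/
def f0 (D : Discretized n K T) (k : Fin K) (j : D.V) : ℝ := if j = D.start k then 1 else 0

end Discretized

/-! ### The linear programming relaxation -/

/-- An assignment of real values to the variables of the integer linear program, for a path with
`N + 1` nodes: `x t i j` is `x_{ij}^t`, `c t j` is `c_j^t`, `f t k j` is `f_{kj}^t`,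
`S t k j l` is `S_{kjl}^t` and `M t k` is the moving cost `S_k^t`. -/
structure FracSol (n K T N : ℕ) where
  x : Fin T → Fin n → Fin (N + 1) → ℝ
  c : Fin T → Fin (N + 1) → ℝ
  f : Fin T → Fin K → Fin (N + 1) → ℝ
  S : Fin T → Fin K → Fin (N + 1) → Fin (N + 1) → ℝ
  M : Fin T → Fin K → ℝ

namespace FracSol

variable {n K T : ℕ} {D : Discretized n K T}

/-- The objective function. -/
def objective (D : Discretized n K T) (z : FracSol n K T D.edges) : ℝ :=
  ∑ t : Fin T, ((∑ i : Fin n, ∑ j : D.V, D.d (D.loc t i) j * z.x t i j) + ∑ k : Fin K, z.M t k)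

/-- Feasibility for the relaxation: all linear constraints of the integer program hold, and each
of the `0`-`1` variables takes a value between `0` and `1`. The sequence `Fin.cons D.f0 z.f` is
`f⁰, f¹, …, f^T`. -/
structure IsFeasible (D : Discretized n K T) (z : FracSol n K T D.edges) : Prop where
  connect : ∀ t i, ∑ j : D.V, z.x t i j = 1
  served : ∀ t i j, z.x t i j ≤ z.c t j
  mass : ∀ t j, z.c t j = ∑ k : Fin K, z.f t k j
  place : ∀ t k, ∑ j : D.V, z.f t k j = 1
  move : ∀ t k, z.M t k = ∑ j : D.V, ∑ l : D.V, D.d j l * z.S t k j l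
  arrive : ∀ t k l, ∑ j : D.V, z.S t k j l = z.f t k l
  depart : ∀ (t : Fin T) k j, ∑ l : D.V, z.S t k j l =
    (Fin.cons D.f0 z.f : Fin (T + 1) → Fin K → D.V → ℝ) t.castSucc k j
  x_mem : ∀ t i j, z.x t i j ∈ Set.Icc (0 : ℝ) 1
  f_mem : ∀ t k j, z.f t k j ∈ Set.Icc (0 : ℝ) 1
  S_mem : ∀ t k j l, z.S t k j l ∈ Set.Icc (0 : ℝ) 1

/-- `z` is an optimal fractional solution. -/
def IsOptimal (D : Discretized n K T) (z : FracSol n K T D.edges) : Prop :=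
  z.IsFeasible D ∧ ∀ z' : FracSol n K T D.edges, z'.IsFeasible D → z.objective D ≤ z'.objective D

/-- At stage `t`, node `j` is where the prefix sum of the facility mass first exceeds `m`.
The index `m` counts from `0`, so this is the node for the `(m + 1)`-st facility. -/
def IsRoundingNode (D : Discretized n K T) (z : FracSol n K T D.edges) (t : Fin T) (m : Fin K)
    (j : D.V) : Prop :=
  ∑ l ∈ Iio j, z.c t l ≤ (m : ℝ) ∧ (m : ℝ) < ∑ l ∈ Iic j, z.c t l

/-- `x` arises by rounding `z`: number the facilities from left to right by their initial
positions (facility `σ m` has number `m`), and put the facility with number `m` on its rounding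
node at each stage. -/
def IsRounding (I : Reallocation n K T) (D : Discretized n K T) (z : FracSol n K T D.edges)
    (x : Fin T → Fin K → ℝ) : Prop :=
  ∃ σ : Equiv.Perm (Fin K), Monotone (I.x0 ∘ σ) ∧
    ∀ t m, ∃ j : D.V, z.IsRoundingNode D t m j ∧ x t (σ m) = D.node j

end FracSol

/-! ### General linear programs and exact solvers for them -/

/-- A linear program with variables `ι` and constraints `ρ`: minimize `∑ v, obj v * z v` subject to
`∑ v, coef r v * z v = rhs r` for the rows with `isEq r = true`, and `≤` for the other rows. -/
structure LinearProgram (ι ρ : Type) where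
  obj : ι → ℝ
  coef : ρ → ι → ℝ
  isEq : ρ → Bool
  rhs : ρ → ℝ

open Classical in
/-- The number of bits of a rational number, numerator and denominator in binary.
The value `0` at irrational numbers is never used. -/
def bitLength (r : ℝ) : ℕ :=
  if h : ∃ q : ℚ, (q : ℝ) = r then h.choose.num.natAbs.size + h.choose.den.size + 1 else 0

/-- `r` is rational. -/
def IsRat (r : ℝ) : Prop := ∃ q : ℚ, (q : ℝ) = r

namespace LinearProgram

variable {ι ρ : Type} [Fintype ι] [Fintype ρ]

def IsFeasible (L : LinearProgram ι ρ) (z : ι → ℝ) : Prop :=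
  ∀ r, if L.isEq r then ∑ v, L.coef r v * z v = L.rhs r else ∑ v, L.coef r v * z v ≤ L.rhs r

def IsOptimal (L : LinearProgram ι ρ) (z : ι → ℝ) : Prop :=
  L.IsFeasible z ∧ ∀ z', L.IsFeasible z' → ∑ v, L.obj v * z v ≤ ∑ v, L.obj v * z' v

/-- All data are rational. -/
def IsRational (L : LinearProgram ι ρ) : Prop :=
  (∀ v, IsRat (L.obj v)) ∧ (∀ r v, IsRat (L.coef r v)) ∧ ∀ r, IsRat (L.rhs r)

/-- The encoding length of a linear program with rational data. -/
def bitSize (L : LinearProgram ι ρ) : ℕ :=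
  Fintype.card ι + Fintype.card ρ + ∑ v, bitLength (L.obj v) +
    ∑ r, ∑ v, bitLength (L.coef r v) + ∑ r, bitLength (L.rhs r)

end LinearProgram

/-- An exact solver for linear programs: it returns an optimal solution of every linear program
that has one, and spends `time L` steps on `L`. -/
structure LPSolver where
  solve : ∀ {ι ρ : Type} [Fintype ι] [Fintype ρ], LinearProgram ι ρ → ι → ℝ
  time : ∀ {ι ρ : Type} [Fintype ι] [Fintype ρ], LinearProgram ι ρ → ℕ
  solve_isOptimal : ∀ {ι ρ : Type} [Fintype ι] [Fintype ρ] (L : LinearProgram ι ρ),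
    (∃ z, L.IsOptimal z) → L.IsOptimal (solve L)

open Classical in
instance : Nonempty LPSolver :=
  ⟨{ solve := fun L => if h : ∃ z, L.IsOptimal z then h.choose else fun _ => 0
     time := fun _ => 0
     solve_isOptimal := fun L h => by
      simp only [h, dif_pos]
      exact h.choose_spec }⟩

/-- The solver takes at most `τ s` steps on rational linear programs of encoding length `s`. -/
def LPSolver.RunsInTime (A : LPSolver) (τ : Polynomial ℕ) : Prop :=
  ∀ {ι ρ : Type} [Fintype ι] [Fintype ρ] (L : LinearProgram ι ρ),
    L.IsRational → A.time L ≤ τ.eval L.bitSize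

/-! ### The relaxation as a linear program in matrix form -/

/-- The `0`-`1` variables of the integer program. -/
inductive BinVar (n K T N : ℕ) : Type
  | x (t : Fin T) (i : Fin n) (j : Fin (N + 1))
  | f (t : Fin T) (k : Fin K) (j : Fin (N + 1))
  | S (t : Fin T) (k : Fin K) (j l : Fin (N + 1))
  deriving DecidableEq, Fintype

/-- All variables of the integer program. -/
inductive Var (n K T N : ℕ) : Type
  | bin (b : BinVar n K T N)
  | c (t : Fin T) (j : Fin (N + 1))
  | M (t : Fin T) (k : Fin K)
  deriving DecidableEq, Fintype

/-- The constraints of the relaxation. -/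
inductive Row (n K T N : ℕ) : Type
  | connect (t : Fin T) (i : Fin n)
  | served (t : Fin T) (i : Fin n) (j : Fin (N + 1))
  | mass (t : Fin T) (j : Fin (N + 1))
  | place (t : Fin T) (k : Fin K)
  | move (t : Fin T) (k : Fin K)
  | arrive (t : Fin T) (k : Fin K) (l : Fin (N + 1))
  | depart (t : Fin T) (k : Fin K) (j : Fin (N + 1))
  | nonneg (b : BinVar n K T N)
  | leOne (b : BinVar n K T N)
  deriving DecidableEq, Fintype

namespace Row

variable {n K T N : ℕ}

/-- The coefficients of the constraints, for a table `d` of the distances. -/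
def coef (d : Fin (N + 1) → Fin (N + 1) → ℝ) : Row n K T N → Var n K T N → ℝ
  | connect t i, .bin (.x t' i' _) => if t' = t ∧ i' = i then 1 else 0
  | served t i j, .bin (.x t' i' j') => if t' = t ∧ i' = i ∧ j' = j then 1 else 0
  | served t _ j, .c t' j' => if t' = t ∧ j' = j then -1 else 0
  | mass t j, .c t' j' => if t' = t ∧ j' = j then 1 else 0
  | mass t j, .bin (.f t' _ j') => if t' = t ∧ j' = j then -1 else 0
  | place t k, .bin (.f t' k' _) => if t' = t ∧ k' = k then 1 else 0
  | move t k, .M t' k' => if t' = t ∧ k' = k then 1 else 0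
  | move t k, .bin (.S t' k' j l) => if t' = t ∧ k' = k then -d j l else 0
  | arrive t k l, .bin (.S t' k' _ l') => if t' = t ∧ k' = k ∧ l' = l then 1 else 0
  | arrive t k l, .bin (.f t' k' l') => if t' = t ∧ k' = k ∧ l' = l then -1 else 0
  | depart t k j, .bin (.S t' k' j' _) => if t' = t ∧ k' = k ∧ j' = j then 1 else 0
  | depart t k j, .bin (.f t' k' j') => if t'.succ = t.castSucc ∧ k' = k ∧ j' = j then -1 else 0
  | nonneg b, .bin b' => if b' = b then -1 else 0
  | leOne b, .bin b' => if b' = b then 1 else 0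
  | _, _ => 0

/-- Which constraints are equations. -/
def isEq : Row n K T N → Bool
  | served _ _ _ => false
  | nonneg _ => false
  | leOne _ => false
  | _ => true

/-- The right-hand sides of the constraints. In the first stage the number `f_{kj}^{t-1}` is a
constant and not a variable. -/
def rhs (start : Fin K → Fin (N + 1)) : Row n K T N → ℝ
  | connect _ _ => 1
  | place _ _ => 1
  | depart t k j => if t.val = 0 ∧ j = start k then 1 else 0
  | leOne _ => 1
  | _ => 0

end Row

/-- The coefficients of the objective function, for a table `d` of the distances. -/
def Var.obj {n K T N : ℕ} (d : Fin (N + 1) → Fin (N + 1) → ℝ)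
    (loc : Fin T → Fin n → Fin (N + 1)) : Var n K T N → ℝ
  | .bin (.x t i j) => d (loc t i) j
  | .M _ _ => 1
  | _ => 0

/-- The relaxation in matrix form. -/
def Discretized.relaxation {n K T : ℕ} (D : Discretized n K T) :
    LinearProgram (Var n K T D.edges) (Row n K T D.edges) where
  obj := Var.obj D.d D.loc
  coef := Row.coef D.d
  isEq := Row.isEq
  rhs := Row.rhs D.start

/-- Reading off the variables from a vector. -/
def FracSol.ofVector {n K T N : ℕ} (z : Var n K T N → ℝ) : FracSol n K T N where
  x t i j := z (.bin (.x t i j))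
  c t j := z (.c t j)
  f t k j := z (.bin (.f t k j))
  S t k j l := z (.bin (.S t k j l))
  M t k := z (.M t k)

/-! ### Computations with a step count -/

/-- The result of a computation together with the number of steps it took. -/
structure Timed (α : Type) where
  val : α
  steps : ℕ

namespace Timed

instance : Monad Timed where
  pure a := ⟨a, 0⟩
  bind m g := ⟨(g m.val).val, m.steps + (g m.val).steps⟩

variable {α ι : Type}

/-- One elementary operation: a comparison, addition, subtraction or assignment. -/
def op (a : α) : Timed α := ⟨a, 1⟩

def lt (a b : ℝ) : Timed Bool := op (decide (a < b))

def add (a b : ℝ) : Timed ℝ := op (a + b)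

def sub (a b : ℝ) : Timed ℝ := op (a - b)

/-- A loop that fills an array entry by entry, with one step for writing each entry. -/
def fill [Fintype ι] (g : ι → Timed α) : Timed (ι → α) :=
  ⟨fun i => (g i).val, ∑ i, ((g i).steps + 1)⟩

/-- A loop that counts the entries `true` of an array. -/
def count [Fintype ι] (b : ι → Bool) : Timed ℕ := ⟨#{i | b i = true}, Fintype.card ι⟩

end Timed

open Timed

/-! ### The algorithm -/

/-- Insertion into an increasing list, unless the number is already there. -/
def insertPos (p : ℝ) : List ℝ → Timed (List ℝ)
  | [] => op [p]
  | q :: l => do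
    if ← lt p q then op (p :: q :: l)
    else if ← lt q p then do
      let l' ← insertPos p l
      op (q :: l')
    else pure (q :: l)

/-- The increasing list of the distinct numbers in a list. -/
def sortDistinct : List ℝ → Timed (List ℝ)
  | [] => op []
  | p :: l => do
    let l' ← sortDistinct l
    insertPos p l'

/-- The index of `p` in a strictly increasing array: the number of entries less than `p`. -/
def findIndex {N : ℕ} (a : Fin (N + 1) → ℝ) (p : ℝ) : Timed (Fin (N + 1)) := do
  let b ← fill fun j => lt (a j) p
  let r ← count b
  op (Fin.ofNat (N + 1) r)

variable {n K T : ℕ}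

/-- Constructing the path. -/
def buildPath (I : Reallocation n K T) : Timed (Discretized n K T) := do
  let l ← sortDistinct
    (List.ofFn I.x0 ++ (List.ofFn fun t => List.ofFn (I.agent t)).flatten)
  let node ← fill fun j : Fin (l.length - 1 + 1) => op (l.getD j 0)
  let loc ← fill fun t => fill fun i => findIndex node (I.agent t i)
  let start ← fill fun k => findIndex node (I.x0 k)
  pure { edges := l.length - 1, node := node, loc := loc, start := start }

/-- The table of the distances of the nodes. -/
def buildDist (D : Discretized n K T) : Timed (D.V → D.V → ℝ) :=
  fill fun j => fill fun l => do
    if ← lt (D.node l) (D.node j) then sub (D.node j) (D.node l)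
    else sub (D.node l) (D.node j)

/-- Writing down the relaxation, entry by entry. -/
def buildLP (D : Discretized n K T) (d : D.V → D.V → ℝ) :
    Timed (LinearProgram (Var n K T D.edges) (Row n K T D.edges)) := do
  let obj ← fill fun v => op (Var.obj d D.loc v)
  let coef ← fill fun r => fill fun v => op (Row.coef d r v)
  let isEq ← fill fun r => op (Row.isEq r)
  let rhs ← fill fun r => op (Row.rhs D.start r)
  pure { obj := obj, coef := coef, isEq := isEq, rhs := rhs }

/-- Running the solver. -/
def callSolver {ι ρ : Type} [Fintype ι] [Fintype ρ] (A : LPSolver) (L : LinearProgram ι ρ) :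
    Timed (ι → ℝ) :=
  ⟨A.solve L, A.time L⟩

/-- The number of facilities to the left of facility `k` initially (ties are broken by the index),
so that facility `k` is the `(facilityRank I k + 1)`-st facility from the left. -/
def facilityRank (I : Reallocation n K T) (k : Fin K) : Timed ℕ := do
  let b ← fill fun k' : Fin K => do
    if ← lt (I.x0 k') (I.x0 k) then pure true
    else if ← lt (I.x0 k) (I.x0 k') then pure false
    else op (decide (k' < k))
  count b

/-- Walks along the entries of a list, the sum of the earlier entries being `s` and their number
being `j`, up to the first entry at which the prefix sum exceeds `r`; returns its index. -/
def firstExceeding (r : ℝ) : List ℝ → ℝ → ℕ → Timed ℕ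
  | [], _, j => pure j
  | a :: l, s, j => do
    let s' ← add s a
    if ← lt r s' then pure j
    else do
      let j' ← op (j + 1)
      firstExceeding r l s' j'

/-- Rounding: at each stage, the facility of rank `r` is put on the first node at which the prefix
sum of the facility mass exceeds `r`. -/
def roundSolution (I : Reallocation n K T) (D : Discretized n K T) (z : FracSol n K T D.edges) :
    Timed (Fin T → Fin K → ℝ) := do
  let rank ← fill fun k => facilityRank I k
  fill fun t => fill fun k => do
    let mass ← fill fun j : D.V => op (z.c t j)
    let j ← firstExceeding (rank k : ℝ) (List.ofFn mass) 0 0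
    op (D.node (Fin.ofNat (D.edges + 1) j))

/-- What the algorithm computes: the path, the fractional solution and the final solution. -/
structure Output (n K T : ℕ) where
  path : Discretized n K T
  frac : FracSol n K T path.edges
  sol : Fin T → Fin K → ℝ

/-- The algorithm: construct the path and the linear program, solve the relaxation, round. -/
def lpRounding (A : LPSolver) (I : Reallocation n K T) : Timed (Output n K T) := do
  let D ← buildPath I
  let d ← buildDist D
  let L ← buildLP D d
  let v ← callSolver A L
  let z := FracSol.ofVector v
  let x ← roundSolution I D z
  pure { path := D, frac := z, sol := x }

/-- All positions of the instance are rational. -/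
def Reallocation.IsRational (I : Reallocation n K T) : Prop :=
  (∀ k, IsRat (I.x0 k)) ∧ ∀ t i, IsRat (I.agent t i)

/-- The encoding length of an instance with rational positions. -/
def Reallocation.bitSize (I : Reallocation n K T) : ℕ :=
  n + K + T + ∑ k, bitLength (I.x0 k) + ∑ t, ∑ i, bitLength (I.agent t i)

end FacilityReallocation

end

open FacilityReallocation

open Finset

noncomputable section

namespace FacilityReallocation

/-! ### Averages over a threshold in the unit interval -/

/-! The rounding belongs to a family: for a threshold `θ` in `[0, 1)`, put the facility with number
`m` (from `0`) on the `m + θ` quantile of the facility mass `c`. The algorithm is the case `θ = 0`.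
A distance on the line is the total length of the edges that separate two points, so costs can be
compared edge by edge.

Facility `m` crosses an edge between two stages exactly when `m + θ` lies between the prefix sums of
`c` there at these stages. As `m` and `θ` vary, `m + θ` sweeps `[0, K)` once, so the average number
of crossings is at most the difference of the prefix sums (`avgLE_sum_abs_threshold`), and every
transport of the mass moves at least that much over the edge (`sum_gap_mul_abs_le`). For an agent at
node `a`, let `s` be the mass left of `a` that does not serve it. Every `θ` has an `m` with `m + θ`
in `[s, s + 1)`, and the average distance of these quantiles from `a` is at most the fractional
connection cost (`exists_avgLE_connection`). Hence the cost at `θ` is dominated by a function whose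
average is at most the LP objective (`exists_avgLE_cost`).

Placements on nodes are feasible for the LP, so at an optimal LP solution no `θ` costs less than the
objective. With the bound on the average, no interval of thresholds can cost more. The quantiles do
not change for small `θ`, so `θ = 0` attains the objective (`cost_of_isRounding`). Arbitrary
positions reduce to nodes by a second random threshold, which rounds inside each edge, fixes the
nodes and does not increase distances on average (`avgLE_abs_snap_sub`).

For the algorithm it remains to identify the computed values with these objects, and to bound the
step counts, the LP dimensions and the bit lengths of its entries by polynomials. -/

/-- The average of `G` over the unit interval exists and is at most `C`. -/
def AvgLE (G : ℝ → ℝ) (C : ℝ) : Prop :=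
  IntervalIntegrable G MeasureTheory.volume 0 1 ∧ ∫ θ in (0 : ℝ)..1, G θ ≤ C

namespace AvgLE

theorem mono {G : ℝ → ℝ} {C C' : ℝ} (h : AvgLE G C) (hC : C ≤ C') : AvgLE G C' :=
  ⟨h.1, h.2.trans hC⟩

theorem add {G H : ℝ → ℝ} {C C' : ℝ} (hG : AvgLE G C) (hH : AvgLE H C') :
    AvgLE (fun θ => G θ + H θ) (C + C') := by
  refine ⟨hG.1.add hH.1, ?_⟩
  rw [intervalIntegral.integral_add hG.1 hH.1]
  exact add_le_add hG.2 hH.2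

theorem const_mul {G : ℝ → ℝ} {C a : ℝ} (ha : 0 ≤ a) (hG : AvgLE G C) :
    AvgLE (fun θ => a * G θ) (a * C) := by
  refine ⟨hG.1.const_mul a, ?_⟩
  rw [intervalIntegral.integral_const_mul]
  exact mul_le_mul_of_nonneg_left hG.2 ha

theorem sum {ι : Type*} (s : Finset ι) {G : ι → ℝ → ℝ} {C : ι → ℝ}
    (h : ∀ i ∈ s, AvgLE (G i) (C i)) : AvgLE (fun θ => ∑ i ∈ s, G i θ) (∑ i ∈ s, C i) := by
  classical
  induction s using Finset.induction_on with
  | empty => exact ⟨by simp, by simp⟩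
  | insert a s ha ih =>
    simp only [sum_insert ha]
    exact (h a (mem_insert_self a s)).add (ih fun i hi => h i (mem_insert_of_mem hi))

/-- Some threshold does at least as well as the average. -/
theorem exists_le {G : ℝ → ℝ} {C : ℝ} (h : AvgLE G C) : ∃ θ, 0 ≤ θ ∧ θ < 1 ∧ G θ ≤ C := by
  by_contra! hc
  have h1 := intervalIntegral.intervalIntegral_pos_of_pos_on (f := fun θ => G θ - C) (a := 0)
    (b := 1) (h.1.sub (by simp)) (fun x hx => sub_pos.2 (hc x hx.1.le hx.2)) one_pos
  rw [intervalIntegral.integral_sub h.1 (by simp)] at h1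
  have := h.2
  simp at h1
  linarith

/-- If `C` is both a lower bound of the function and an upper bound of the average, then lower
bounds near `0` are at most `C`. -/
theorem le_of_forall {G : ℝ → ℝ} {B C ε : ℝ} (h : AvgLE G C) (hε : 0 < ε)
    (hC : ∀ θ, 0 ≤ θ → θ < 1 → C ≤ G θ) (hB : ∀ θ, 0 ≤ θ → θ < 1 → θ < ε → B ≤ G θ) :
    B ≤ C := by
  by_contra! hBC
  set δ := min ε 1
  have hδ : 0 < δ := lt_min hε one_pos
  have hδ1 : δ ≤ 1 := min_le_right _ _
  have i1 : IntervalIntegrable G MeasureTheory.volume 0 δ :=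
    h.1.mono_set (by
      rw [Set.uIcc_of_le hδ.le, Set.uIcc_of_le zero_le_one]
      exact Set.Icc_subset_Icc le_rfl hδ1)
  have i2 : IntervalIntegrable G MeasureTheory.volume δ 1 :=
    h.1.mono_set (by
      rw [Set.uIcc_of_le hδ1, Set.uIcc_of_le zero_le_one]
      exact Set.Icc_subset_Icc hδ.le le_rfl)
  have e := intervalIntegral.integral_add_adjacent_intervals i1 i2
  have b1 : ∫ _ in (0 : ℝ)..δ, B ≤ ∫ θ in (0 : ℝ)..δ, G θ :=
    intervalIntegral.integral_mono_on_of_le_Ioo hδ.le (by simp) i1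
      fun x hx => hB x hx.1.le (hx.2.trans_le hδ1) (hx.2.trans_le (min_le_left _ _))
  have b2 : ∫ _ in δ..1, C ≤ ∫ θ in δ..1, G θ :=
    intervalIntegral.integral_mono_on_of_le_Ioo hδ1 (by simp) i2
      fun x hx => hC x (hδ.le.trans hx.1.le) hx.2
  have := h.2
  simp only [intervalIntegral.integral_const, smul_eq_mul] at b1 b2
  -- The two pieces give at least `δ * B + (1 - δ) * C`, which exceeds `C` because `δ * (B - C) >
  -- 0`.
  nlinarith

end AvgLE

/-- The indicator function of the interval from `a` to `b`. -/
def box (a b : ℝ) : ℝ → ℝ := (Set.Ico a b).indicator fun _ => 1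

theorem box_of_mem {a b u : ℝ} (h1 : a ≤ u) (h2 : u < b) : box a b u = 1 :=
  Set.indicator_of_mem (show u ∈ Set.Ico a b from ⟨h1, h2⟩) _

theorem box_of_lt {a b u : ℝ} (h : u < a) : box a b u = 0 :=
  Set.indicator_of_notMem (fun h' => h.not_ge h'.1) _

theorem box_of_ge {a b u : ℝ} (h : b ≤ u) : box a b u = 0 :=
  Set.indicator_of_notMem (fun h' => h.not_gt h'.2) _

theorem box_nonneg (a b u : ℝ) : 0 ≤ box a b u :=
  Set.indicator_nonneg (fun _ _ => zero_le_one) _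

theorem integrable_box (a b : ℝ) : MeasureTheory.Integrable (box a b) :=
  (MeasureTheory.integrable_indicator_iff measurableSet_Ico).2 (by simp)

theorem integral_box_le (a b : ℝ) {c d : ℝ} (hcd : c ≤ d) :
    ∫ u in c..d, box a b u ≤ max 0 (b - a) := by
  rw [intervalIntegral.integral_of_le hcd]
  refine (MeasureTheory.setIntegral_le_integral (integrable_box a b)
    (Filter.Eventually.of_forall (box_nonneg a b))).trans ?_
  rw [box, MeasureTheory.integral_indicator measurableSet_Ico]
  simp [max_comm]

theorem avgLE_box (a b : ℝ) : AvgLE (box a b) (max 0 (b - a)) :=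
  ⟨(integrable_box a b).intervalIntegrable, integral_box_le a b zero_le_one⟩

/-- The translates of the unit interval by `0, …, K - 1` tile `[0, K]`, so averaging over `θ` and
summing over `m` is one integral over `[0, K]`. -/
theorem avgLE_sum_box (K : ℕ) (a b : ℝ) :
    AvgLE (fun θ => ∑ m : Fin K, box a b (m + θ)) (max 0 (b - a)) := by
  have hint : ∀ m : ℝ, IntervalIntegrable (fun θ => box a b (m + θ)) MeasureTheory.volume 0 1 :=
    fun m => ((integrable_box a b).comp_add_left m).intervalIntegrable
  refine ⟨by simpa [Finset.sum_fn] using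
    IntervalIntegrable.sum univ fun (m : Fin K) _ => hint m, ?_⟩
  beta_reduce
  rw [intervalIntegral.integral_finsetSum fun (m : Fin K) _ => hint (m : ℕ)]
  simp only [intervalIntegral.integral_comp_add_left]
  rw [Fin.sum_univ_eq_sum_range fun m : ℕ => ∫ u in (m : ℝ) + 0..(m : ℝ) + 1, box a b u]
  have := intervalIntegral.sum_integral_adjacent_intervals (f := box a b)
    (μ := MeasureTheory.volume) (a := fun m : ℕ => (m : ℝ)) (n := K)
    fun k _ => (integrable_box a b).intervalIntegrable
  simp only [Nat.cast_add, Nat.cast_one, Nat.cast_zero] at this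
  simp only [add_zero, this]
  exact integral_box_le a b (Nat.cast_nonneg K)

/-! ### Cuts of a path -/

section Gap

variable {N : ℕ}

/-- The increments of a sequence on a path; the last one is `0`. -/
def gap (F : Fin (N + 1) → ℝ) (e : Fin (N + 1)) : ℝ := F (Order.succ e) - F e

theorem gap_nonneg {F : Fin (N + 1) → ℝ} (hF : Monotone F) (e : Fin (N + 1)) : 0 ≤ gap F e :=
  sub_nonneg.2 (hF (Order.le_succ e))

theorem sum_gap (F : Fin (N + 1) → ℝ) (j : Fin (N + 1)) :
    ∑ e ∈ Iio j, gap F e = F j - F 0 := by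
  induction j using Fin.induction with
  | zero =>
    rw [sub_self]
    exact sum_eq_zero fun e he => absurd (mem_Iio.1 he) (Fin.not_lt_zero e)
  | succ i ih =>
    have h : Iio i.succ = insert i.castSucc (Iio i.castSucc) := by
      ext e
      simp only [mem_Iio, mem_insert, Fin.lt_def, Fin.ext_iff, Fin.val_succ, Fin.val_castSucc]
      omega
    rw [h, sum_insert (by simp), ih, gap, Fin.orderSucc_castSucc]
    ring

theorem sum_ite_gap (F : Fin (N + 1) → ℝ) (j : Fin (N + 1)) :
    ∑ e, (if e < j then gap F e else 0) = F j - F 0 := by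
  rw [← sum_gap, ← sum_filter]
  congr 1
  ext; simp

/-- The cut decomposition behind all cost comparisons: `e < j` says that node `j` lies beyond edge
`e`, so the absolute value is `1` exactly on the edges between the two nodes. -/
theorem abs_sub_eq_sum_gap {F : Fin (N + 1) → ℝ} (hF : Monotone F) (j l : Fin (N + 1)) :
    |F j - F l| = ∑ e, gap F e * |(if e < j then 1 else 0) - (if e < l then 1 else 0)| := by
  wlog hjl : l ≤ j generalizing j l
  · rw [abs_sub_comm, this l j (le_of_not_ge hjl)]
    simp only [abs_sub_comm]
  rw [abs_of_nonneg (sub_nonneg.2 (hF hjl)),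
    show F j - F l = (F j - F 0) - (F l - F 0) by ring, ← sum_ite_gap, ← sum_ite_gap,
    ← sum_sub_distrib]
  refine sum_congr rfl fun e _ => ?_
  by_cases h1 : e < l
  · simp [h1, h1.trans_le hjl]
  · by_cases h2 : e < j <;> simp [h1, h2]

end Gap

/-! ### Quantiles of a mass distribution on a path -/

section Quantile

variable {N : ℕ}

/-- The node at which the prefix sum of the masses first exceeds `u`. -/
def IsQuantile (c : Fin (N + 1) → ℝ) (u : ℝ) (j : Fin (N + 1)) : Prop :=
  ∑ l ∈ Iio j, c l ≤ u ∧ u < ∑ l ∈ Iic j, c l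

/-- Prefix sums of nonnegative masses increase. Together with `abs_sub_eq_sum_gap` this turns
distances of quantiles into threshold conditions on prefix sums. -/
theorem IsQuantile.lt_iff {c : Fin (N + 1) → ℝ} (hc : ∀ l, 0 ≤ c l) {u : ℝ} {j : Fin (N + 1)}
    (h : IsQuantile c u j) (e : Fin (N + 1)) : e < j ↔ ∑ l ∈ Iic e, c l ≤ u := by
  constructor
  · intro he
    refine le_trans (sum_le_sum_of_subset_of_nonneg ?_ fun i _ _ => hc i) h.1
    intro l hl
    exact mem_Iio.2 ((mem_Iic.1 hl).trans_lt he)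
  · intro he
    by_contra! hj
    have : ∑ l ∈ Iic j, c l ≤ ∑ l ∈ Iic e, c l :=
      sum_le_sum_of_subset_of_nonneg (Iic_subset_Iic.2 hj) fun i _ _ => hc i
    linarith [h.2]

theorem existsUnique_isQuantile {c : Fin (N + 1) → ℝ} (hc : ∀ l, 0 ≤ c l) {u : ℝ} (h0 : 0 ≤ u)
    (h1 : u < ∑ l, c l) : ∃! j, IsQuantile c u j := by
  set S : Finset (Fin (N + 1)) := {j | u < ∑ l ∈ Iic j, c l}
  have hS : S.Nonempty := by
    refine ⟨Fin.last N, ?_⟩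
    have : Iic (Fin.last N) = univ := by ext e; simp [Fin.le_last]
    simp [S, this, h1]
  have hmem : u < ∑ l ∈ Iic (S.min' hS), c l := by simpa [S] using S.min'_mem hS
  have hmin : ∀ i, i < S.min' hS → ∑ l ∈ Iic i, c l ≤ u := by
    intro i hi
    by_contra! h
    exact hi.not_ge (S.min'_le i (by simp [S, h]))
  refine ⟨S.min' hS, ⟨?_, hmem⟩, ?_⟩
  · generalize S.min' hS = j at hmin
    induction j using Fin.cases with
    | zero =>
      rw [sum_eq_zero fun e he => absurd (mem_Iio.1 he) (Fin.not_lt_zero e)]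
      exact h0
    | succ i =>
      have : Iio i.succ = Iic i.castSucc := by
        ext e
        simp [Fin.lt_def, Fin.le_def]
      rw [this]
      exact hmin _ (Fin.castSucc_lt_succ)
  · intro j hj
    refine le_antisymm ?_ (S.min'_le j (by simp [S, hj.2]))
    by_contra! h
    exact absurd hmem (not_lt.2 ((hj.lt_iff hc _).1 h))

theorem sum_ite_lt (b : Fin (N + 1) → ℝ) (e : Fin (N + 1)) :
    ∑ j, (if e < j then 1 else 0) * b j = ∑ j, b j - ∑ j ∈ Iic e, b j := by
  rw [eq_sub_iff_add_eq, show ∑ j ∈ Iic e, b j = ∑ j, if j ≤ e then b j else 0 by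
    rw [← sum_filter]; congr 1; ext; simp, ← sum_add_distrib]
  refine sum_congr rfl fun j _ => ?_
  by_cases h : e < j
  · simp [h, h.not_ge]
  · simp [h, not_lt.1 h]

/-- The cost of a transport of mass is at least the mass that has to cross the cuts. -/
theorem sum_gap_mul_abs_le {F : Fin (N + 1) → ℝ} (hF : Monotone F)
    {S : Fin (N + 1) → Fin (N + 1) → ℝ} (hS : ∀ j l, 0 ≤ S j l) :
    ∑ e, gap F e * |∑ l ∈ Iic e, ∑ j, S j l - ∑ j ∈ Iic e, ∑ l, S j l| ≤
      ∑ j, ∑ l, |F j - F l| * S j l := by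
  -- The change of the prefix sum at `e` is the net flow over this cut; the right-hand side is the
  -- flow in both directions together.
  have key : ∀ e, |∑ l ∈ Iic e, ∑ j, S j l - ∑ j ∈ Iic e, ∑ l, S j l| ≤
      ∑ j, ∑ l, |(if e < j then (1 : ℝ) else 0) - (if e < l then 1 else 0)| * S j l := by
    intro e
    have h1 := sum_ite_lt (fun l => ∑ j, S j l) e
    have h2 := sum_ite_lt (fun j => ∑ l, S j l) e
    have h3 : ∑ l, ∑ j, S j l = ∑ j, ∑ l, S j l := sum_comm
    have h4 : ∑ l ∈ Iic e, ∑ j, S j l - ∑ j ∈ Iic e, ∑ l, S j l =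
        ∑ j, ∑ l, ((if e < j then (1 : ℝ) else 0) - (if e < l then 1 else 0)) * S j l := by
      simp only [sub_mul, sum_sub_distrib, ← mul_sum]
      rw [h2, sum_comm (f := fun j l => (if e < l then (1 : ℝ) else 0) * S j l)]
      simp only [← mul_sum]
      rw [h1]
      linarith
    rw [h4]
    refine (abs_sum_le_sum_abs _ _).trans (sum_le_sum fun j _ =>
      (abs_sum_le_sum_abs _ _).trans (sum_le_sum fun l _ => ?_))
    rw [abs_mul, abs_of_nonneg (hS j l)]
  refine (sum_le_sum fun e _ => mul_le_mul_of_nonneg_left (key e) (gap_nonneg hF e)).trans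
    (le_of_eq ?_)
  simp only [mul_sum, abs_sub_eq_sum_gap hF, sum_mul]
  rw [sum_comm]
  refine sum_congr rfl fun j _ => ?_
  rw [sum_comm]
  simp only [mul_assoc]

/-- The distances of the quantiles of two distributions cost on average at most what has to cross
the cuts. -/
theorem avgLE_sum_abs_threshold {F : Fin (N + 1) → ℝ} (hF : Monotone F) (K : ℕ)
    (P Q : Fin (N + 1) → ℝ) :
    AvgLE (fun θ => ∑ m : Fin K, ∑ e, gap F e *
        |(if P e ≤ m + θ then 1 else 0) - (if Q e ≤ m + θ then 1 else 0)|)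
      (∑ e, gap F e * |P e - Q e|) := by
  have h := AvgLE.sum univ fun (e : Fin (N + 1)) _ =>
    (avgLE_sum_box K (min (P e) (Q e)) (max (P e) (Q e))).const_mul (gap_nonneg hF e)
  convert h.mono (C' := ∑ e, gap F e * |P e - Q e|) (le_of_eq (sum_congr rfl fun e _ => by
    rw [max_sub_min_eq_abs, max_eq_right (abs_nonneg (Q e - P e)), abs_sub_comm])) using 2 with θ
  simp only [mul_sum]
  rw [sum_comm]
  refine sum_congr rfl fun e _ => sum_congr rfl fun m _ => ?_
  congr 1
  -- The two indicators differ exactly when `m + θ` lies in the half-open interval between the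
  -- smaller and the larger prefix sum.
  by_cases h1 : P e ≤ m + θ <;> by_cases h2 : Q e ≤ m + θ
  · rw [box_of_ge (max_le h1 h2)]; simp [h1, h2]
  · rw [box_of_mem ((min_le_left _ _).trans h1) (lt_max_of_lt_right (not_le.1 h2))]; simp [h1, h2]
  · rw [box_of_mem ((min_le_right _ _).trans h2) (lt_max_of_lt_left (not_le.1 h1))]; simp [h1, h2]
  · rw [box_of_lt (lt_min (not_le.1 h1) (not_le.1 h2))]; simp [h1, h2]

/-- On average, the distance of a node to the nearest quantile is at most the cost of serving it
fractionally. -/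
theorem exists_avgLE_connection {F : Fin (N + 1) → ℝ} (hF : Monotone F) {K : ℕ}
    {c x : Fin (N + 1) → ℝ} (hx : ∀ j, 0 ≤ x j) (hxc : ∀ j, x j ≤ c j) (hx1 : ∑ j, x j = 1)
    (hcK : ∑ j, c j = K) (a : Fin (N + 1)) :
    ∃ G : ℝ → ℝ, AvgLE G (∑ j, |F a - F j| * x j) ∧
      ∀ θ, 0 ≤ θ → θ < 1 → ∀ q : Fin K → Fin (N + 1), (∀ m : Fin K, IsQuantile c (m + θ) (q m)) →
        ∃ m, |F a - F (q m)| ≤ G θ := by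
  have hc : ∀ j, 0 ≤ c j := fun j => (hx j).trans (hxc j)
  set P : Fin (N + 1) → ℝ := fun e => ∑ l ∈ Iic e, c l
  set X : Fin (N + 1) → ℝ := fun e => ∑ l ∈ Iic e, x l
  -- The surplus mass left of `a`. The window `[s, s + 1)` has length `1`, so every `θ` puts some `m
  -- + θ` into it.
  set s : ℝ := ∑ l ∈ Iio a, (c l - x l)
  have hcx : ∀ l, 0 ≤ c l - x l := fun l => sub_nonneg.2 (hxc l)
  have hPX : ∀ e, P e - X e = ∑ l ∈ Iic e, (c l - x l) := fun e => sum_sub_distrib _ _ |>.symm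
  have hs0 : 0 ≤ s := sum_nonneg fun l _ => hcx l
  have hsK : s + 1 ≤ K := by
    have : s ≤ ∑ l, (c l - x l) :=
      sum_le_sum_of_subset_of_nonneg (subset_univ _) fun i _ _ => hcx i
    rw [sum_sub_distrib] at this
    linarith
  have hX0 : ∀ e, 0 ≤ X e := fun e => sum_nonneg fun l _ => hx l
  have hX1 : ∀ e, X e ≤ 1 := fun e => by
    rw [← hx1]
    exact sum_le_sum_of_subset_of_nonneg (subset_univ _) fun i _ _ => hx i
  -- For `u` in the window this is the distance from `a` to the `u`-quantile, edge by edge. Outside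
  -- the window only `0 ≤ H u` is needed.
  set H : ℝ → ℝ := fun u =>
    ∑ e, gap F e * (if e < a then box s (P e) u else box (P e) (s + 1) u)
  have hH0 : ∀ u, 0 ≤ H u := fun u => sum_nonneg fun e _ =>
    mul_nonneg (gap_nonneg hF e) (by split_ifs <;> exact box_nonneg _ _ _)
  refine ⟨fun θ => ∑ m : Fin K, H (m + θ), ?_, ?_⟩
  -- An edge left of `a` is used by the service mass `X e` at or before it, an edge right of `a` by
  -- the remaining `1 - X e`.
  · have hcost : ∑ j, |F a - F j| * x j = ∑ e, gap F e * (if e < a then X e else 1 - X e) := by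
      simp only [abs_sub_eq_sum_gap hF, sum_mul]
      rw [sum_comm]
      refine sum_congr rfl fun e _ => ?_
      simp only [mul_assoc, ← mul_sum]
      congr 1
      have h1 := sum_ite_lt x e
      rw [hx1] at h1
      split_ifs with he
      · have : ∀ j, |(1 : ℝ) - (if e < j then 1 else 0)| * x j =
            x j - (if e < j then 1 else 0) * x j := by
          intro j
          split_ifs <;> simp
        simp only [this, sum_sub_distrib, h1, hx1]
        ring
      · rw [← h1]
        refine sum_congr rfl fun j _ => ?_
        split_ifs <;> simp
    rw [hcost]
    have h := AvgLE.sum univ fun (e : Fin (N + 1)) _ =>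
      AvgLE.const_mul (C := if e < a then X e else 1 - X e)
        (G := fun θ => ∑ m : Fin K, if e < a then box s (P e) (m + θ) else
          box (P e) (s + 1) (m + θ)) (gap_nonneg hF e) (by
        split_ifs with he
        · refine (avgLE_sum_box K s (P e)).mono (max_le (hX0 e) ?_)
          -- The surplus up to `e` is at most `s` for `e` left of `a`, and in the other case at
          -- least `s`. So the boxes are no longer than the service mass that uses the edge.
          have : P e - X e ≤ s := by
            rw [hPX]
            exact sum_le_sum_of_subset_of_nonneg
              (fun l hl => mem_Iio.2 ((mem_Iic.1 hl).trans_lt he)) fun i _ _ => hcx i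
          linarith
        · refine (avgLE_sum_box K (P e) (s + 1)).mono (max_le (sub_nonneg.2 (hX1 e)) ?_)
          have : s ≤ P e - X e := by
            rw [hPX]
            exact sum_le_sum_of_subset_of_nonneg
              (fun l hl => mem_Iic.2 ((mem_Iio.1 hl).le.trans (not_lt.1 he))) fun i _ _ => hcx i
          linarith)
    convert h using 2 with θ
    simp only [mul_sum, H]
    rw [sum_comm]
  · intro θ h0 h1 q hq
    -- The index with `m + θ` in the window. The natural ceiling is `0` for `s ≤ θ`, which is still
    -- inside because `θ < 1 ≤ s + 1`.
    have hm1 : s - θ ≤ ⌈s - θ⌉₊ := Nat.le_ceil _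
    have hm2 : (⌈s - θ⌉₊ : ℝ) + θ < s + 1 := by
      rcases le_total (s - θ) 0 with h | h
      · rw [Nat.ceil_eq_zero.2 h]
        push_cast
        linarith
      · linarith [Nat.ceil_lt_add_one h]
    generalize ⌈s - θ⌉₊ = m at hm1 hm2
    have hmK : m < K := by
      have : (m : ℝ) < K := by linarith
      exact_mod_cast this
    refine ⟨⟨m, hmK⟩, ?_⟩
    have hle : ∀ H : ℝ → ℝ, (∀ u, 0 ≤ H u) → ∀ i : Fin K, H (i + θ) ≤ ∑ m : Fin K, H (m + θ) :=
      fun H hH i =>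
        Finset.single_le_sum (f := fun m : Fin K => H (m + θ)) (fun i _ => hH _) (mem_univ i)
    refine le_trans (le_of_eq ?_) (hle H hH0 ⟨m, hmK⟩)
    rw [abs_sub_eq_sum_gap hF]
    refine sum_congr rfl fun e _ => ?_
    congr 1
    have hlt := (hq ⟨m, hmK⟩).lt_iff hc e
    by_cases he : e < a
    · by_cases hP : P e ≤ m + θ
      · rw [if_pos he, if_pos (hlt.2 hP), if_pos he, box_of_ge hP]; simp
      · rw [if_pos he, if_neg (fun h => hP (hlt.1 h)), if_pos he,
          box_of_mem (by linarith) (not_le.1 hP)]; simp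
    · by_cases hP : P e ≤ m + θ
      · rw [if_neg he, if_pos (hlt.2 hP), if_neg he, box_of_mem hP hm2]; simp
      · rw [if_neg he, if_neg (fun h => hP (hlt.1 h)), if_neg he, box_of_lt (not_le.1 hP)]; simp

end Quantile

variable {n K T : ℕ}

/-! ### Rounding a fractional solution -/

theorem cost_eq [NeZero K] {D : Discretized n K T} {I : Reallocation n K T}
    (hD : D.IsDiscretizationOf I) (w : Fin T → Fin K → D.V) :
    I.cost (fun t k => D.node (w t k)) = ∑ t : Fin T,
      ((∑ k, D.d ((Fin.cons D.start w : Fin (T + 1) → Fin K → D.V) t.succ k)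
          ((Fin.cons D.start w : Fin (T + 1) → Fin K → D.V) t.castSucc k)) +
        ∑ i, univ.inf' univ_nonempty fun k : Fin K => D.d (D.loc t i) (w t k)) := by
  have h : ∀ s k, (Fin.cons I.x0 (fun t k => D.node (w t k)) : Fin (T + 1) → Fin K → ℝ) s k =
      D.node ((Fin.cons D.start w : Fin (T + 1) → Fin K → D.V) s k) := by
    intro s k
    induction s using Fin.cases with
    | zero => simp [hD.start_eq]
    | succ t => simp
  simp only [Reallocation.cost, Discretized.d, h, hD.loc_eq]

/-- The fractional placement of facility `k` at the stages `0, …, T`. -/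
def FracSol.placement {D : Discretized n K T} (z : FracSol n K T D.edges) :
    Fin (T + 1) → Fin K → D.V → ℝ :=
  Fin.cons D.f0 z.f

namespace FracSol.IsFeasible

variable {D : Discretized n K T} {z : FracSol n K T D.edges}

theorem c_nonneg (hz : z.IsFeasible D) (t : Fin T) (j : D.V) : 0 ≤ z.c t j := by
  rw [hz.mass]
  exact sum_nonneg fun k _ => (hz.f_mem t k j).1

theorem sum_c (hz : z.IsFeasible D) (t : Fin T) : ∑ j, z.c t j = K := by
  simp only [hz.mass]
  rw [sum_comm]
  simp [hz.place]

theorem sum_gap_le_M (hz : z.IsFeasible D) (hD : Monotone D.node) (t : Fin T) (k : Fin K) :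
    ∑ e, gap D.node e * |∑ l ∈ Iic e, z.placement t.succ k l -
      ∑ l ∈ Iic e, z.placement t.castSucc k l| ≤ z.M t k := by
  rw [hz.move]
  refine le_trans (le_of_eq ?_) (sum_gap_mul_abs_le hD fun j l => (hz.S_mem t k j l).1)
  simp only [hz.arrive, hz.depart]
  rfl

theorem sum_gap_le_sum_M (hz : z.IsFeasible D) (hD : Monotone D.node) (t : Fin T) :
    ∑ e, gap D.node e * |∑ l ∈ Iic e, ∑ k, z.placement t.succ k l -
      ∑ l ∈ Iic e, ∑ k, z.placement t.castSucc k l| ≤ ∑ k, z.M t k := by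
  refine le_trans ?_ (sum_le_sum fun k _ => hz.sum_gap_le_M hD t k)
  rw [sum_comm]
  refine sum_le_sum fun e _ => ?_
  rw [← mul_sum]
  refine mul_le_mul_of_nonneg_left ?_ (gap_nonneg hD e)
  rw [sum_comm, sum_comm (s := Iic e), ← sum_sub_distrib]
  exact abs_sum_le_sum_abs _ _

end FracSol.IsFeasible

/-- The initial prefix sums count facilities and are integers, so a shift by `θ < 1` changes
nothing: for every `θ` the sorted initial positions are the quantiles at `m + θ`. -/
theorem lt_start_iff {D : Discretized n K T} {σ : Equiv.Perm (Fin K)}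
    (hσ : Monotone (D.start ∘ σ)) {θ : ℝ} (h0 : 0 ≤ θ) (h1 : θ < 1) (m : Fin K) (e : D.V) :
    e < D.start (σ m) ↔ ∑ l ∈ Iic e, ∑ k, D.f0 k l ≤ m + θ := by
  have hcount : ∑ l ∈ Iic e, ∑ k, D.f0 k l = (#{m' | D.start (σ m') ≤ e} : ℝ) := by
    rw [sum_comm, ← Equiv.sum_comp σ]
    simp [Discretized.f0]
  rw [hcount]
  constructor
  · intro he
    have hsub : ({m' | D.start (σ m') ≤ e} : Finset (Fin K)) ⊆ Iio m := by
      intro m' hm'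
      rw [mem_filter] at hm'
      rw [mem_Iio]
      by_contra! h
      exact (he.trans_le (hσ h)).not_ge hm'.2
    have := card_le_card hsub
    rw [Fin.card_Iio] at this
    have : (#{m' | D.start (σ m') ≤ e} : ℝ) ≤ m := by exact_mod_cast this
    linarith
  · intro hle
    by_contra! he
    have hsub : Iic m ⊆ ({m' | D.start (σ m') ≤ e} : Finset (Fin K)) := by
      intro m' hm'
      rw [mem_filter]
      exact ⟨mem_univ _, (hσ (mem_Iic.1 hm')).trans he⟩
    have := card_le_card hsub
    rw [Fin.card_Iic] at this
    have : (m : ℝ) + 1 ≤ (#{m' | D.start (σ m') ≤ e} : ℝ) := by exact_mod_cast this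
    linarith

theorem monotone_start_comp {D : Discretized n K T} {I : Reallocation n K T}
    (hD : D.IsDiscretizationOf I) {σ : Equiv.Perm (Fin K)} (hσ : Monotone (I.x0 ∘ σ)) :
    Monotone (D.start ∘ σ) := by
  intro a b hab
  rw [← hD.strictMono.le_iff_le]
  simpa [hD.start_eq] using hσ hab

/-- Placing the facilities at the quantiles `m + θ` of the facility mass costs on average over `θ`
at most as much as the fractional solution. -/
theorem exists_avgLE_cost [NeZero K] {D : Discretized n K T} {I : Reallocation n K T}
    (hD : D.IsDiscretizationOf I) {z : FracSol n K T D.edges} (hz : z.IsFeasible D)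
    {σ : Equiv.Perm (Fin K)} (hσ : Monotone (I.x0 ∘ σ)) :
    ∃ G : ℝ → ℝ, AvgLE G (z.objective D) ∧
      ∀ θ, 0 ≤ θ → θ < 1 → ∀ w : Fin T → Fin K → D.V,
        (∀ t (m : Fin K), IsQuantile (z.c t) (m + θ) (w t (σ m))) →
          I.cost (fun t k => D.node (w t k)) ≤ G θ := by
  have hmono := hD.strictMono.monotone
  have hconn := fun t i => exists_avgLE_connection hmono (fun j => (hz.x_mem t i j).1)
    (hz.served t i) (hz.connect t i) (hz.sum_c t) (D.loc t i)
  choose G hG hGle using hconn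
  set C : Fin (T + 1) → D.V → ℝ := fun s e => ∑ l ∈ Iic e, ∑ k, z.placement s k l
  -- Averaging this majorant instead of the cost itself avoids any question of measurability of the
  -- chosen quantiles.
  refine ⟨fun θ => ∑ t : Fin T, ((∑ i, G t i θ) + ∑ m : Fin K, ∑ e, gap D.node e *
      |(if C t.succ e ≤ m + θ then 1 else 0) - (if C t.castSucc e ≤ m + θ then 1 else 0)|),
    ?_, ?_⟩
  · refine AvgLE.sum _ fun t _ => (AvgLE.sum _ fun i _ => hG t i).add ?_
    exact (avgLE_sum_abs_threshold hmono K _ _).mono (hz.sum_gap_le_sum_M hmono t)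
  · intro θ h0 h1 w hw
    rw [cost_eq hD]
    refine sum_le_sum fun t _ => ?_
    rw [add_comm]
    refine add_le_add (sum_le_sum fun i _ => ?_) (le_of_eq ?_)
    · obtain ⟨m, hm⟩ := hGle t i θ h0 h1 (fun m => w t (σ m)) (hw t)
      exact (inf'_le _ (mem_univ (σ m))).trans hm
    · rw [← Equiv.sum_comp σ]
      have hlt : ∀ (s : Fin (T + 1)) (m : Fin K) (e : D.V),
          e < (Fin.cons D.start w : Fin (T + 1) → Fin K → D.V) s (σ m) ↔ C s e ≤ m + θ := by
        intro s m e
        induction s using Fin.cases with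
        | zero => exact lt_start_iff (monotone_start_comp hD hσ) h0 h1 m e
        | succ t =>
          have := (hw t m).lt_iff (hz.c_nonneg t) e
          simp only [hz.mass] at this
          exact this
      refine sum_congr rfl fun m _ => ?_
      rw [Discretized.d, abs_sub_eq_sum_gap hmono]
      simp only [hlt]

/-! ### Integral solutions -/

/-- The fractional solution that belongs to a placement of the facilities at nodes. -/
theorem exists_isFeasible_of_placement [NeZero K] {D : Discretized n K T} {I : Reallocation n K T}
    (hD : D.IsDiscretizationOf I) (w : Fin T → Fin K → D.V) :
    ∃ z : FracSol n K T D.edges, z.IsFeasible D ∧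
      z.objective D = I.cost (fun t k => D.node (w t k)) := by
  have hnear : ∀ t i, ∃ k, (univ.inf' univ_nonempty fun k : Fin K => D.d (D.loc t i) (w t k)) =
      D.d (D.loc t i) (w t k) := fun t i => by
    obtain ⟨k, -, hk⟩ := exists_mem_eq_inf' (univ_nonempty (α := Fin K))
      fun k : Fin K => D.d (D.loc t i) (w t k)
    exact ⟨k, hk⟩
  choose κ hκ using hnear
  set W : Fin (T + 1) → Fin K → D.V := Fin.cons D.start w
  have hW : (Fin.cons D.f0 (fun t k j => if j = w t k then 1 else 0) :
      Fin (T + 1) → Fin K → D.V → ℝ) = fun s k j => if j = W s k then 1 else 0 := by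
    funext s k j
    induction s using Fin.cases with
    | zero => rfl
    | succ t => rfl
  -- All `0`-`1` variables are indicators. Serving each agent from its nearest facility `κ t i`
  -- gives equality with the minimum in the cost.
  refine ⟨{ x := fun t i j => if j = w t (κ t i) then 1 else 0
            c := fun t j => ∑ k, if j = w t k then 1 else 0
            f := fun t k j => if j = w t k then 1 else 0
            S := fun t k j l => if j = W t.castSucc k ∧ l = W t.succ k then 1 else 0
            M := fun t k => D.d (W t.castSucc k) (W t.succ k) }, ?_, ?_⟩
  · constructor
    · intro t i; simp
    · intro t i j
      exact Finset.single_le_sum (f := fun k => if j = w t k then (1 : ℝ) else 0)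
        (fun k _ => by split_ifs <;> norm_num) (mem_univ (κ t i))
    · intro t j; rfl
    · intro t k; simp
    · intro t k; simp [ite_and]
    · intro t k l; simp [ite_and, W]
    · intro t k j
      rw [hW]
      simp [ite_and]
    all_goals
      intros
      dsimp only
      split_ifs <;> simp
  · rw [cost_eq hD]
    refine sum_congr rfl fun t _ => ?_
    rw [add_comm]
    congr 1
    · exact sum_congr rfl fun k _ => abs_sub_comm _ _
    · exact sum_congr rfl fun i _ => by simp [hκ]

/-! ### Moving arbitrary positions to nodes -/

section Snap

variable {N : ℕ}

theorem gap_last (F : Fin (N + 1) → ℝ) : gap F (Fin.last N) = 0 := by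
  simp [gap, Fin.orderSucc_last]

theorem sum_gap_univ (F : Fin (N + 1) → ℝ) : ∑ e, gap F e = F (Fin.last N) - F 0 := by
  have h := sum_gap F (Fin.last N)
  rw [← h, ← sum_subset (subset_univ (Iio (Fin.last N)))]
  intro e _ he
  rw [mem_Iio, not_lt, Fin.last_le_iff] at he
  rw [he, gap_last]

/-- The part of the edge from `F e` to the next node that lies to the left of `y`. -/
def covered (F : Fin (N + 1) → ℝ) (y : ℝ) : Fin (N + 1) → ℝ := gap fun e => min y (F e)

theorem covered_mono {F : Fin (N + 1) → ℝ} (hF : Monotone F) {y y' : ℝ} (h : y ≤ y')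
    (e : Fin (N + 1)) : covered F y e ≤ covered F y' e := by
  have := hF (Order.le_succ e)
  simp only [covered, gap]
  rcases min_cases y (F e) with h1 | h1 <;> rcases min_cases y (F (Order.succ e)) with h2 | h2 <;>
    rcases min_cases y' (F e) with h3 | h3 <;>
    rcases min_cases y' (F (Order.succ e)) with h4 | h4 <;> linarith

theorem covered_of_le {F : Fin (N + 1) → ℝ} (hF : Monotone F) {y : ℝ} {e : Fin (N + 1)}
    (h : y ≤ F e) : covered F y e = 0 := by
  simp [covered, gap, h, h.trans (hF (Order.le_succ e))]

theorem covered_of_ge {F : Fin (N + 1) → ℝ} (hF : Monotone F) {y : ℝ} {e : Fin (N + 1)}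
    (h : F (Order.succ e) ≤ y) : covered F y e = gap F e := by
  simp [covered, gap, h, (hF (Order.le_succ e)).trans h]

theorem covered_le_gap {F : Fin (N + 1) → ℝ} (hF : Monotone F) (y : ℝ) (e : Fin (N + 1)) :
    covered F y e ≤ gap F e :=
  (covered_mono hF (le_max_left y (F (Order.succ e))) e).trans
    (covered_of_ge hF (le_max_right _ _)).le

/-- Rounding `y` to a node: inside an edge, to the right end if more than the fraction `θ` of the
edge is covered. -/
def snap (F : Fin (N + 1) → ℝ) (θ y : ℝ) : ℝ :=
  F 0 + ∑ e, if θ * gap F e < covered F y e then gap F e else 0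

/-- The edges that pass the threshold form an initial segment: edges before `y` are fully covered,
edges after it not at all, and `θ` decides only on the edge that contains `y`. -/
theorem exists_snap_eq {F : Fin (N + 1) → ℝ} (hF : StrictMono F) {θ : ℝ} (h0 : 0 ≤ θ) (h1 : θ < 1)
    (y : ℝ) : ∃ j, snap F θ y = F j := by
  -- The first failing edge yields the node. The last index has gap `0` and always fails, so there
  -- is one.
  set S : Finset (Fin (N + 1)) := {e | ¬θ * gap F e < covered F y e}
  have hS : S.Nonempty := by
    refine ⟨Fin.last N, ?_⟩
    have := covered_le_gap hF.monotone y (Fin.last N)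
    rw [gap_last] at this
    simp [S, gap_last, this]
  have hmem : ¬θ * gap F (S.min' hS) < covered F y (S.min' hS) := by
    simpa [S] using S.min'_mem hS
  have hmin : ∀ i, i < S.min' hS → θ * gap F i < covered F y i := by
    intro i hi
    by_contra! h
    exact hi.not_ge (S.min'_le i (by simp [S, h]))
  generalize S.min' hS = j at hmem hmin
  refine ⟨j, ?_⟩
  have : ∀ e, (if θ * gap F e < covered F y e then gap F e else 0) =
      if e < j then gap F e else 0 := by
    intro e
    refine if_congr ⟨fun he => ?_, hmin e⟩ rfl rfl
    by_contra! hj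
    rcases hj.eq_or_lt with rfl | hj
    · exact hmem he
    · refine hmem ?_
      have hy : F e < y := by
        by_contra! hy
        rw [covered_of_le hF.monotone hy] at he
        exact he.not_ge (mul_nonneg h0 (gap_nonneg hF.monotone e))
      rw [covered_of_ge hF.monotone ((hF.monotone (Order.succ_le_of_lt hj)).trans hy.le)]
      have : 0 < gap F j := sub_pos.2 (hF (Order.lt_succ_of_not_isMax hj.not_isMax))
      nlinarith
  simp only [snap, this, sum_ite_gap]
  ring

theorem snap_node {F : Fin (N + 1) → ℝ} (hF : Monotone F) {θ : ℝ} (h0 : 0 ≤ θ) (h1 : θ < 1)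
    (a : Fin (N + 1)) : snap F θ (F a) = F a := by
  have : ∀ e, (if θ * gap F e < covered F (F a) e then gap F e else 0) =
      if e < a then gap F e else 0 := by
    intro e
    have hg := gap_nonneg hF e
    by_cases he : e < a
    · rw [covered_of_ge hF (hF (Order.succ_le_of_lt he)), if_pos he]
      split_ifs with h
      · rfl
      · nlinarith
    · rw [covered_of_le hF (hF (not_lt.1 he)), if_neg he, if_neg (by nlinarith)]
  simp only [snap, this, sum_ite_gap]
  ring

/-- On average over the threshold, rounding does not increase distances. -/
theorem avgLE_abs_snap_sub {F : Fin (N + 1) → ℝ} (hF : Monotone F) (y y' : ℝ) :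
    AvgLE (fun θ => |snap F θ y - snap F θ y'|) |y - y'| := by
  wlog h : y ≤ y' generalizing y y'
  · simp only [abs_sub_comm _ (snap F _ y'), abs_sub_comm _ y']
    exact this y' y (le_of_not_ge h)
  -- The sum telescopes to the distance of the two points clamped to the path, and clamping does not
  -- increase distances.
  have hsum : ∑ e, (covered F y' e - covered F y e) ≤ |y - y'| := by
    rw [sum_sub_distrib, covered, covered, sum_gap_univ, sum_gap_univ, abs_sub_comm,
      abs_of_nonneg (sub_nonneg.2 h)]
    have := hF (Fin.zero_le (Fin.last N))
    rcases min_cases y (F 0) with h1 | h1 <;> rcases min_cases y (F (Fin.last N)) with h2 | h2 <;>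
      rcases min_cases y' (F 0) with h3 | h3 <;>
      rcases min_cases y' (F (Fin.last N)) with h4 | h4 <;> linarith
  -- The two roundings differ on edge `e` when `θ` lies between the covered fractions. If the gap is
  -- `0`, the quotients are junk values, but the factor `gap F e` removes them.
  have hkey := AvgLE.sum univ fun (e : Fin (N + 1)) _ =>
    ((avgLE_box (covered F y e / gap F e) (covered F y' e / gap F e)).const_mul
      (gap_nonneg hF e)).mono (C' := covered F y' e - covered F y e) (by
        have hm := sub_nonneg.2 (covered_mono hF h e)
        rcases (gap_nonneg hF e).eq_or_lt with hg | hg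
        · rw [← hg, zero_mul]
          exact hm
        · rw [← sub_div, max_eq_right (div_nonneg hm hg.le), mul_div_cancel₀ _ hg.ne'])
  convert hkey.mono hsum using 2 with θ
  have hterm : ∀ e, gap F e * box (covered F y e / gap F e) (covered F y' e / gap F e) θ =
      (if θ * gap F e < covered F y' e then gap F e else 0) -
        if θ * gap F e < covered F y e then gap F e else 0 := by
    intro e
    have hm := covered_mono hF h e
    rcases (gap_nonneg hF e).eq_or_lt with hg | hg
    · simp [← hg]
    · by_cases h1 : θ * gap F e < covered F y e
      · rw [box_of_lt ((lt_div_iff₀ hg).2 h1), if_pos h1, if_pos (h1.trans_le hm)]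
        simp
      · by_cases h2 : θ * gap F e < covered F y' e
        · rw [box_of_mem ((div_le_iff₀ hg).2 (not_lt.1 h1)) ((lt_div_iff₀ hg).2 h2), if_neg h1,
            if_pos h2]
          simp
        · rw [box_of_ge ((div_le_iff₀ hg).2 (not_lt.1 h2)), if_neg h1, if_neg h2]
          simp
  rw [abs_sub_comm, snap, snap, add_sub_add_left_eq_sub, ← sum_sub_distrib]
  simp only [← hterm]
  exact abs_of_nonneg (sum_nonneg fun e _ => mul_nonneg (gap_nonneg hF e) (box_nonneg _ _ _))

end Snap

/-- Some solution that uses nodes only is at least as good as a given solution. -/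
theorem exists_placement_cost_le [NeZero K] {D : Discretized n K T} {I : Reallocation n K T}
    (hD : D.IsDiscretizationOf I) (y : Fin T → Fin K → ℝ) :
    ∃ w : Fin T → Fin K → D.V, I.cost (fun t k => D.node (w t k)) ≤ I.cost y := by
  have hmono := hD.strictMono.monotone
  have hnear : ∀ t i, ∃ k, (univ.inf' univ_nonempty fun k : Fin K => |I.agent t i - y t k|) =
      |I.agent t i - y t k| := fun t i => by
    obtain ⟨k, -, hk⟩ := exists_mem_eq_inf' (univ_nonempty (α := Fin K))
      fun k : Fin K => |I.agent t i - y t k|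
    exact ⟨k, hk⟩
  choose κ hκ using hnear
  set Y : Fin (T + 1) → Fin K → ℝ := Fin.cons I.x0 y
  -- One threshold is shared by all stages, facilities and agents. Agents and initial positions are
  -- nodes, so rounding leaves them in place.
  have havg : AvgLE (fun θ => ∑ t : Fin T,
      ((∑ k, |snap D.node θ (Y t.succ k) - snap D.node θ (Y t.castSucc k)|) +
        ∑ i, |snap D.node θ (I.agent t i) - snap D.node θ (y t (κ t i))|)) (I.cost y) := by
    simp only [Reallocation.cost, hκ]
    exact AvgLE.sum _ fun t _ =>
      (AvgLE.sum _ fun k _ => avgLE_abs_snap_sub hmono _ _).add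
        (AvgLE.sum _ fun i _ => avgLE_abs_snap_sub hmono _ _)
  obtain ⟨θ, h0, h1, hθ⟩ := havg.exists_le
  choose w hw using fun t k => exists_snap_eq hD.strictMono h0 h1 (y t k)
  refine ⟨w, le_trans ?_ hθ⟩
  have hW : ∀ s k, (Fin.cons I.x0 (fun t k => D.node (w t k)) : Fin (T + 1) → Fin K → ℝ) s k =
      snap D.node θ (Y s k) := by
    intro s k
    induction s using Fin.cases with
    | zero =>
      change I.x0 k = snap D.node θ (I.x0 k)
      rw [← hD.start_eq, snap_node hmono h0 h1]
    | succ t => exact (hw t k).symm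
  simp only [Reallocation.cost, hW]
  refine sum_le_sum fun t _ => add_le_add le_rfl (sum_le_sum fun i _ => ?_)
  refine (inf'_le _ (mem_univ (κ t i))).trans (le_of_eq ?_)
  rw [hw, ← hD.loc_eq, snap_node hmono h0 h1]

/-! ### Optimal fractional solutions -/

theorem existsUnique_isRoundingNode {D : Discretized n K T} {z : FracSol n K T D.edges}
    (hz : z.IsFeasible D) (t : Fin T) (m : Fin K) : ∃! j : D.V, z.IsRoundingNode D t m j :=
  existsUnique_isQuantile (hz.c_nonneg t) (Nat.cast_nonneg _)
    (by rw [hz.sum_c]; exact_mod_cast m.2)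

theorem exists_perm_monotone (a : Fin K → ℝ) : ∃ σ : Equiv.Perm (Fin K), Monotone (a ∘ σ) :=
  ⟨Tuple.sort a, Tuple.monotone_sort a⟩

/-- The quantiles at `m + θ`, as a placement of the facilities. -/
theorem exists_isQuantile_placement {D : Discretized n K T} {z : FracSol n K T D.edges}
    (hz : z.IsFeasible D) (σ : Equiv.Perm (Fin K)) {θ : ℝ} (h0 : 0 ≤ θ) (h1 : θ < 1) :
    ∃ w : Fin T → Fin K → D.V, ∀ t (m : Fin K), IsQuantile (z.c t) (m + θ) (w t (σ m)) := by
  have h : ∀ t (m : Fin K), ∃ j, IsQuantile (z.c t) (m + θ) j := fun t m =>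
    (existsUnique_isQuantile (hz.c_nonneg t) (by positivity) (by
      rw [hz.sum_c]
      have : (m : ℝ) + 1 ≤ K := by exact_mod_cast m.2
      linarith)).exists
  choose q hq using h
  exact ⟨fun t k => q t (σ.symm k), fun t m => by simpa using hq t m⟩

theorem exists_placement_cost_le_objective [NeZero K] {D : Discretized n K T}
    {I : Reallocation n K T} (hD : D.IsDiscretizationOf I) {z : FracSol n K T D.edges}
    (hz : z.IsFeasible D) :
    ∃ w : Fin T → Fin K → D.V, I.cost (fun t k => D.node (w t k)) ≤ z.objective D := by
  obtain ⟨σ, hσ⟩ := exists_perm_monotone I.x0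
  obtain ⟨G, hG, hGle⟩ := exists_avgLE_cost hD hz hσ
  obtain ⟨θ, h0, h1, hθ⟩ := hG.exists_le
  obtain ⟨w, hw⟩ := exists_isQuantile_placement hz σ h0 h1
  exact ⟨w, (hGle θ h0 h1 w hw).trans hθ⟩

/-- No compactness is needed: there are finitely many placements on nodes, and each feasible point
costs at least as much as one of them. -/
theorem exists_isOptimal [NeZero K] {D : Discretized n K T} {I : Reallocation n K T}
    (hD : D.IsDiscretizationOf I) : ∃ z : FracSol n K T D.edges, z.IsOptimal D := by
  obtain ⟨w, hw⟩ := Finite.exists_min fun w : Fin T → Fin K → D.V =>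
    I.cost fun t k => D.node (w t k)
  obtain ⟨z, hz, hzw⟩ := exists_isFeasible_of_placement hD w
  refine ⟨z, hz, fun z' hz' => ?_⟩
  obtain ⟨w', hw'⟩ := exists_placement_cost_le_objective hD hz'
  exact hzw.le.trans ((hw w').trans hw')

/-- Rounding an optimal fractional solution costs nothing and gives an optimal solution. -/
theorem cost_of_isRounding [NeZero K] {D : Discretized n K T} {I : Reallocation n K T}
    (hD : D.IsDiscretizationOf I) {z : FracSol n K T D.edges} (hz : z.IsOptimal D)
    {x : Fin T → Fin K → ℝ} (hx : z.IsRounding I D x) :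
    I.cost x = z.objective D ∧ ∀ y : Fin T → Fin K → ℝ, I.cost x ≤ I.cost y := by
  obtain ⟨σ, hσ, hj⟩ := hx
  choose q hq hqx using hj
  have hlow : ∀ w : Fin T → Fin K → D.V, z.objective D ≤ I.cost fun t k => D.node (w t k) := by
    intro w
    obtain ⟨z', hz', hzw⟩ := exists_isFeasible_of_placement hD w
    exact (hz.2 z' hz').trans hzw.le
  set w₀ : Fin T → Fin K → D.V := fun t k => q t (σ.symm k)
  have hxw : x = fun t k => D.node (w₀ t k) := by
    funext t k
    simpa using hqx t (σ.symm k)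
  have hw₀ : ∀ t (m : Fin K), w₀ t (σ m) = q t m := fun t m => by simp [w₀]
  -- The least slack in the strict inequalities for the rounding nodes: for `θ < ε` the same nodes
  -- are the quantiles at `m + θ`. Without stages any `ε` will do.
  obtain ⟨ε, hε, hεle⟩ : ∃ ε > 0, ∀ p : Fin T × Fin K,
      (p.2 : ℝ) + ε ≤ ∑ l ∈ Iic (q p.1 p.2), z.c p.1 l := by
    rcases isEmpty_or_nonempty (Fin T × Fin K) with h | h
    · exact ⟨1, one_pos, fun p => h.elim p⟩
    · obtain ⟨p, hp⟩ := Finite.exists_min fun p : Fin T × Fin K =>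
        ∑ l ∈ Iic (q p.1 p.2), z.c p.1 l - (p.2 : ℝ)
      exact ⟨_, sub_pos.2 (hq p.1 p.2).2, fun p' => by linarith [hp p']⟩
  obtain ⟨G, hG, hGle⟩ := exists_avgLE_cost hD hz.1 hσ
  have hcost : I.cost x ≤ z.objective D := by
    refine hG.le_of_forall hε (fun θ h0 h1 => ?_) fun θ h0 h1 h2 => ?_
    · obtain ⟨w, hw⟩ := exists_isQuantile_placement hz.1 σ h0 h1
      exact (hlow w).trans (hGle θ h0 h1 w hw)
    · rw [hxw]
      refine hGle θ h0 h1 w₀ fun t m => ?_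
      rw [hw₀]
      exact ⟨by linarith [(hq t m).1], by linarith [hεle (t, m)]⟩
  refine ⟨hcost.antisymm (hxw ▸ hlow w₀), fun y => ?_⟩
  obtain ⟨w, hw⟩ := exists_placement_cost_le hD y
  exact hcost.trans ((hlow w).trans hw)

/-! ### The relaxation in matrix form -/

section Matrix

variable {N : ℕ}

/-- The `0`-`1` variables, kind by kind. -/
def binVarEquiv : BinVar n K T N ≃ (Fin T × Fin n × Fin (N + 1)) ⊕
    (Fin T × Fin K × Fin (N + 1)) ⊕ (Fin T × Fin K × Fin (N + 1) × Fin (N + 1)) where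
  toFun
    | .x t i j => .inl (t, i, j)
    | .f t k j => .inr (.inl (t, k, j))
    | .S t k j l => .inr (.inr (t, k, j, l))
  invFun
    | .inl (t, i, j) => .x t i j
    | .inr (.inl (t, k, j)) => .f t k j
    | .inr (.inr (t, k, j, l)) => .S t k j l
  left_inv v := by cases v <;> rfl
  right_inv v := by rcases v with _ | _ | _ <;> rfl

/-- The variables, kind by kind. -/
def varEquiv : Var n K T N ≃ BinVar n K T N ⊕ (Fin T × Fin (N + 1)) ⊕ (Fin T × Fin K) where
  toFun
    | .bin b => .inl b
    | .c t j => .inr (.inl (t, j))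
    | .M t k => .inr (.inr (t, k))
  invFun
    | .inl b => .bin b
    | .inr (.inl (t, j)) => .c t j
    | .inr (.inr (t, k)) => .M t k
  left_inv v := by cases v <;> rfl
  right_inv v := by rcases v with _ | _ | _ <;> rfl

/-- The constraints, kind by kind. -/
def rowEquiv : Row n K T N ≃ (Fin T × Fin n) ⊕ (Fin T × Fin n × Fin (N + 1)) ⊕
    (Fin T × Fin (N + 1)) ⊕ (Fin T × Fin K) ⊕ (Fin T × Fin K) ⊕ (Fin T × Fin K × Fin (N + 1)) ⊕
    (Fin T × Fin K × Fin (N + 1)) ⊕ BinVar n K T N ⊕ BinVar n K T N where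
  toFun
    | .connect t i => .inl (t, i)
    | .served t i j => .inr (.inl (t, i, j))
    | .mass t j => .inr (.inr (.inl (t, j)))
    | .place t k => .inr (.inr (.inr (.inl (t, k))))
    | .move t k => .inr (.inr (.inr (.inr (.inl (t, k)))))
    | .arrive t k l => .inr (.inr (.inr (.inr (.inr (.inl (t, k, l))))))
    | .depart t k j => .inr (.inr (.inr (.inr (.inr (.inr (.inl (t, k, j)))))))
    | .nonneg b => .inr (.inr (.inr (.inr (.inr (.inr (.inr (.inl b)))))))
    | .leOne b => .inr (.inr (.inr (.inr (.inr (.inr (.inr (.inr b)))))))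
  invFun
    | .inl (t, i) => .connect t i
    | .inr (.inl (t, i, j)) => .served t i j
    | .inr (.inr (.inl (t, j))) => .mass t j
    | .inr (.inr (.inr (.inl (t, k)))) => .place t k
    | .inr (.inr (.inr (.inr (.inl (t, k))))) => .move t k
    | .inr (.inr (.inr (.inr (.inr (.inl (t, k, l)))))) => .arrive t k l
    | .inr (.inr (.inr (.inr (.inr (.inr (.inl (t, k, j))))))) => .depart t k j
    | .inr (.inr (.inr (.inr (.inr (.inr (.inr (.inl b))))))) => .nonneg b
    | .inr (.inr (.inr (.inr (.inr (.inr (.inr (.inr b))))))) => .leOne b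
  left_inv r := by cases r <;> rfl
  right_inv r := by rcases r with _ | _ | _ | _ | _ | _ | _ | _ | _ <;> rfl

theorem sum_binVar (g : BinVar n K T N → ℝ) : ∑ b, g b =
    ∑ t, ∑ i, ∑ j, g (.x t i j) + (∑ t, ∑ k, ∑ j, g (.f t k j) +
      ∑ t, ∑ k, ∑ j, ∑ l, g (.S t k j l)) := by
  rw [← Equiv.sum_comp binVarEquiv.symm]
  simp only [Fintype.sum_sum_type, Fintype.sum_prod_type]
  rfl

theorem sum_var (g : Var n K T N → ℝ) : ∑ v, g v =
    ∑ b, g (.bin b) + (∑ t, ∑ j, g (.c t j) + ∑ t, ∑ k, g (.M t k)) := by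
  rw [← Equiv.sum_comp varEquiv.symm]
  simp only [Fintype.sum_sum_type, Fintype.sum_prod_type]
  rfl

theorem card_binVar : Fintype.card (BinVar n K T N) =
    T * (n * (N + 1)) + (T * (K * (N + 1)) + T * (K * ((N + 1) * (N + 1)))) := by
  simp [Fintype.card_congr binVarEquiv]

theorem card_var : Fintype.card (Var n K T N) =
    Fintype.card (BinVar n K T N) + (T * (N + 1) + T * K) := by
  simp [Fintype.card_congr varEquiv]

theorem card_row : Fintype.card (Row n K T N) =
    T * n + (T * (n * (N + 1)) + (T * (N + 1) + (T * K + (T * K + (T * (K * (N + 1)) +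
      (T * (K * (N + 1)) + (Fintype.card (BinVar n K T N) +
        Fintype.card (BinVar n K T N)))))))) := by
  simp [Fintype.card_congr rowEquiv]

theorem FracSol.ofVector_surjective :
    Function.Surjective (FracSol.ofVector : (Var n K T N → ℝ) → FracSol n K T N) := fun z =>
  ⟨fun
    | .bin (.x t i j) => z.x t i j
    | .bin (.f t k j) => z.f t k j
    | .bin (.S t k j l) => z.S t k j l
    | .c t j => z.c t j
    | .M t k => z.M t k, rfl⟩

end Matrix

theorem relaxation_objective (D : Discretized n K T) (v : Var n K T D.edges → ℝ) :
    ∑ i, D.relaxation.obj i * v i = (FracSol.ofVector v).objective D := by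
  simp [Discretized.relaxation, sum_var, sum_binVar, Var.obj, FracSol.objective, FracSol.ofVector,
    sum_add_distrib]

/-- At the first stage no `t'` satisfies `t'.succ = t.castSucc`, and the constant `f⁰` appears on
the right-hand side instead; at later stages it is a variable. -/
theorem sum_coef_depart (D : Discretized n K T) (v : Var n K T D.edges → ℝ) (t : Fin T) (k : Fin K)
    (j : D.V) : ∑ i, Row.coef D.d (.depart t k j) i * v i = D.relaxation.rhs (.depart t k j) ↔
      ∑ l, v (.bin (.S t k j l)) =
        (Fin.cons D.f0 (FracSol.ofVector v).f : Fin (T + 1) → Fin K → D.V → ℝ) t.castSucc k j := by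
  cases T with
  | zero => exact t.elim0
  | succ T =>
    induction t using Fin.cases with
    | zero =>
      simp [sum_var, sum_binVar, Row.coef, Discretized.relaxation, Row.rhs, ite_and, Discretized.f0,
        Fin.succ_ne_zero]
    | succ t =>
      have h2 : (Fin.cons D.f0 (FracSol.ofVector v).f : Fin (T + 1 + 1) → Fin K → D.V → ℝ)
          t.succ.castSucc k j = v (.bin (.f t.castSucc k j)) := by
        rw [← Fin.succ_castSucc, Fin.cons_succ]; rfl
      rw [h2]
      simp [sum_var, sum_binVar, Row.coef, Discretized.relaxation, Row.rhs, ite_and]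
      constructor <;> intro h <;> linarith

theorem relaxation_isFeasible_iff (D : Discretized n K T) (v : Var n K T D.edges → ℝ) :
    D.relaxation.IsFeasible v ↔ (FracSol.ofVector v).IsFeasible D := by
  have hrow : D.relaxation.IsFeasible v ↔ ∀ r, if Row.isEq r then
      ∑ i, Row.coef D.d r i * v i = D.relaxation.rhs r else
      ∑ i, Row.coef D.d r i * v i ≤ D.relaxation.rhs r := Iff.rfl
  rw [hrow]
  have e1 : ∀ t i, ∑ j, Row.coef D.d (.connect t i) j * v j = ∑ j, v (.bin (.x t i j)) := by
    intro t i
    simp [sum_var, sum_binVar, Row.coef, ite_and]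
  have e2 : ∀ t i j, ∑ l, Row.coef D.d (.served t i j) l * v l =
      v (.bin (.x t i j)) - v (.c t j) := by
    intro t i j
    simp [sum_var, sum_binVar, Row.coef, ite_and, sub_eq_add_neg]
  have e3 : ∀ t j, ∑ l, Row.coef D.d (.mass t j) l * v l =
      v (.c t j) - ∑ k, v (.bin (.f t k j)) := by
    intro t j
    simp [sum_var, sum_binVar, Row.coef, ite_and]
    ring
  have e4 : ∀ t k, ∑ l, Row.coef D.d (.place t k) l * v l = ∑ j, v (.bin (.f t k j)) := by
    intro t k
    simp [sum_var, sum_binVar, Row.coef, ite_and]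
  have e5 : ∀ t k, ∑ l, Row.coef D.d (.move t k) l * v l =
      v (.M t k) - ∑ j, ∑ l, D.d j l * v (.bin (.S t k j l)) := by
    intro t k
    simp [sum_var, sum_binVar, Row.coef, ite_and]
    ring
  have e6 : ∀ t k l, ∑ i, Row.coef D.d (.arrive t k l) i * v i =
      ∑ j, v (.bin (.S t k j l)) - v (.bin (.f t k l)) := by
    intro t k l
    simp [sum_var, sum_binVar, Row.coef, ite_and]
    ring
  have e7 : ∀ b, ∑ i, Row.coef D.d (.nonneg b) i * v i = - v (.bin b) := by
    intro b
    simp [sum_var, Row.coef]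
  have e8 : ∀ b, ∑ i, Row.coef D.d (.leOne b) i * v i = v (.bin b) := by
    intro b
    simp [sum_var, Row.coef]
  constructor
  · intro h
    have hb : ∀ b, v (.bin b) ∈ Set.Icc (0 : ℝ) 1 := fun b =>
      ⟨by simpa [Row.isEq, e7, Discretized.relaxation, Row.rhs, FracSol.ofVector]
        using h (.nonneg b),
        by simpa [Row.isEq, e8, Discretized.relaxation, Row.rhs, FracSol.ofVector]
          using h (.leOne b)⟩
    refine ⟨fun t i => ?_, fun t i j => ?_, fun t j => ?_, fun t k => ?_, fun t k => ?_,
      fun t k l => ?_, fun t k j => ?_, fun t i j => hb _, fun t k j => hb _, fun t k j l => hb _⟩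
    · simpa [Row.isEq, e1, Discretized.relaxation, Row.rhs, FracSol.ofVector] using h (.connect t i)
    · simpa [Row.isEq, e2, Discretized.relaxation, Row.rhs, FracSol.ofVector]
        using h (.served t i j)
    · simpa [Row.isEq, e3, Discretized.relaxation, Row.rhs, FracSol.ofVector, sub_eq_zero]
        using h (.mass t j)
    · simpa [Row.isEq, e4, Discretized.relaxation, Row.rhs, FracSol.ofVector] using h (.place t k)
    · simpa [Row.isEq, e5, Discretized.relaxation, Row.rhs, FracSol.ofVector, sub_eq_zero]
        using h (.move t k)
    · simpa [Row.isEq, e6, Discretized.relaxation, Row.rhs, FracSol.ofVector, sub_eq_zero]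
        using h (.arrive t k l)
    · exact (sum_coef_depart D v t k j).1 (by simpa [Row.isEq] using h (.depart t k j))
  · intro h r
    have hb : ∀ b, v (.bin b) ∈ Set.Icc (0 : ℝ) 1
      | .x t i j => h.x_mem t i j
      | .f t k j => h.f_mem t k j
      | .S t k j l => h.S_mem t k j l
    cases r with
    | connect t i =>
      simpa [Row.isEq, e1, Discretized.relaxation, Row.rhs, FracSol.ofVector] using h.connect t i
    | served t i j =>
      simpa [Row.isEq, e2, Discretized.relaxation, Row.rhs, FracSol.ofVector] using h.served t i j
    | mass t j =>
      simpa [Row.isEq, e3, Discretized.relaxation, Row.rhs, FracSol.ofVector, sub_eq_zero]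
        using h.mass t j
    | place t k =>
      simpa [Row.isEq, e4, Discretized.relaxation, Row.rhs, FracSol.ofVector] using h.place t k
    | move t k =>
      simpa [Row.isEq, e5, Discretized.relaxation, Row.rhs, FracSol.ofVector, sub_eq_zero]
        using h.move t k
    | arrive t k l =>
      simpa [Row.isEq, e6, Discretized.relaxation, Row.rhs, FracSol.ofVector, sub_eq_zero]
        using h.arrive t k l
    | depart t k j =>
      simpa [Row.isEq] using (sum_coef_depart D v t k j).2 (h.depart t k j)
    | nonneg b =>
      simpa [Row.isEq, e7, Discretized.relaxation, Row.rhs, FracSol.ofVector] using (hb b).1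
    | leOne b =>
      simpa [Row.isEq, e8, Discretized.relaxation, Row.rhs, FracSol.ofVector] using (hb b).2

theorem relaxation_isOptimal_iff (D : Discretized n K T) (v : Var n K T D.edges → ℝ) :
    D.relaxation.IsOptimal v ↔ (FracSol.ofVector v).IsOptimal D := by
  simp only [LinearProgram.IsOptimal, FracSol.IsOptimal, relaxation_objective,
    relaxation_isFeasible_iff, FracSol.ofVector_surjective.forall]

/-- The solver promises something only for programs that have an optimum, so `exists_isOptimal` is
needed here. -/
theorem isOptimal_solve [NeZero K] (A : LPSolver) {D : Discretized n K T} {I : Reallocation n K T}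
    (hD : D.IsDiscretizationOf I) :
    (FracSol.ofVector (A.solve D.relaxation)).IsOptimal D := by
  rw [← relaxation_isOptimal_iff]
  obtain ⟨z, hz⟩ := exists_isOptimal hD
  obtain ⟨v, rfl⟩ := FracSol.ofVector_surjective z
  exact A.solve_isOptimal _ ⟨v, (relaxation_isOptimal_iff D v).2 hz⟩

open Timed

/-! ### What the algorithm computes -/

section Timed

variable {α β ι : Type}

theorem Timed.val_bind (m : Timed α) (g : α → Timed β) : (m >>= g).val = (g m.val).val := rfl

theorem Timed.steps_bind (m : Timed α) (g : α → Timed β) :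
    (m >>= g).steps = m.steps + (g m.val).steps := rfl

theorem Timed.steps_fill_le [Fintype ι] (g : ι → Timed α) {b : ℕ} (h : ∀ i, (g i).steps ≤ b) :
    (fill g).steps ≤ Fintype.card ι * (b + 1) := by
  have := sum_le_card_nsmul univ (fun i => (g i).steps + 1) (b + 1)
    fun i _ => Nat.succ_le_succ (h i)
  rwa [smul_eq_mul, card_univ] at this

end Timed

theorem insertPos_cons (p q : ℝ) (l : List ℝ) : insertPos p (q :: l) =
    if p < q then ⟨p :: q :: l, 2⟩
    else if q < p then ⟨q :: (insertPos p l).val, (insertPos p l).steps + 3⟩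
    else ⟨q :: l, 2⟩ := by
  by_cases h1 : p < q
  · simp [insertPos, Timed.lt, op, Bind.bind, h1]
  · by_cases h2 : q < p
    · simp [insertPos, Timed.lt, op, Bind.bind, h1, h2]
      ring
    · simp [insertPos, Timed.lt, op, Bind.bind, Pure.pure, h1, h2]

theorem mem_insertPos (p : ℝ) (l : List ℝ) (x : ℝ) :
    x ∈ (insertPos p l).val ↔ x = p ∨ x ∈ l := by
  induction l with
  | nil => simp [insertPos, op]
  | cons q l ih =>
    rw [insertPos_cons]
    split_ifs with h1 h2
    · simp
    · simp [ih, or_left_comm]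
    · have : p = q := le_antisymm (not_lt.1 h2) (not_lt.1 h1)
      simp [this]

theorem pairwise_insertPos (p : ℝ) {l : List ℝ} (h : l.Pairwise (· < ·)) :
    (insertPos p l).val.Pairwise (· < ·) := by
  induction l with
  | nil => simp [insertPos, op]
  | cons q l ih =>
    rw [insertPos_cons]
    obtain ⟨hq, hl⟩ := List.pairwise_cons.1 h
    split_ifs with h1 h2
    · refine List.pairwise_cons.2 ⟨fun x hx => ?_, h⟩
      rcases List.mem_cons.1 hx with rfl | hx
      · exact h1
      · exact h1.trans (hq x hx)
    · refine List.pairwise_cons.2 ⟨fun x hx => ?_, ih hl⟩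
      rcases (mem_insertPos p l x).1 hx with rfl | hx
      · exact h2
      · exact hq x hx
    · exact h

theorem length_insertPos_le (p : ℝ) (l : List ℝ) : (insertPos p l).val.length ≤ l.length + 1 := by
  induction l with
  | nil => simp [insertPos, op]
  | cons q l ih =>
    rw [insertPos_cons]
    split_ifs <;> simp [ih]

theorem steps_insertPos_le (p : ℝ) (l : List ℝ) : (insertPos p l).steps ≤ 3 * l.length + 1 := by
  induction l with
  | nil => simp [insertPos, op]
  | cons q l ih =>
    rw [insertPos_cons, List.length_cons]
    split_ifs <;> dsimp only <;> omega

theorem mem_sortDistinct (l : List ℝ) (x : ℝ) : x ∈ (sortDistinct l).val ↔ x ∈ l := by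
  induction l with
  | nil => simp [sortDistinct, op]
  | cons p l ih => rw [sortDistinct, Timed.val_bind, mem_insertPos, ih, List.mem_cons]

theorem pairwise_sortDistinct (l : List ℝ) : (sortDistinct l).val.Pairwise (· < ·) := by
  induction l with
  | nil => simp [sortDistinct, op]
  | cons p l ih => exact pairwise_insertPos p ih

theorem length_sortDistinct_le (l : List ℝ) : (sortDistinct l).val.length ≤ l.length := by
  induction l with
  | nil => simp [sortDistinct, op]
  | cons p l ih => exact (length_insertPos_le p _).trans (Nat.succ_le_succ ih)

theorem steps_sortDistinct_le (l : List ℝ) :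
    (sortDistinct l).steps ≤ l.length * (3 * l.length) + 1 := by
  induction l with
  | nil => simp [sortDistinct, op]
  | cons p l ih =>
    rw [sortDistinct, Timed.steps_bind, List.length_cons]
    have h1 := steps_insertPos_le p (sortDistinct l).val
    have h2 := length_sortDistinct_le l
    nlinarith

theorem val_findIndex {N : ℕ} {a : Fin (N + 1) → ℝ} (ha : StrictMono a) (j : Fin (N + 1)) :
    (findIndex a (a j)).val = j := by
  have h : (findIndex a (a j)).val = Fin.ofNat (N + 1) #{i | decide (a i < a j) = true} := rfl
  have h2 : ({i | decide (a i < a j) = true} : Finset (Fin (N + 1))) = Iio j := by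
    ext i
    simp [ha.lt_iff_lt]
  rw [h, h2, Fin.card_Iio]
  simp

theorem steps_findIndex {N : ℕ} (a : Fin (N + 1) → ℝ) (p : ℝ) :
    (findIndex a p).steps = 3 * (N + 1) + 1 := by
  simp [findIndex, Timed.steps_bind, fill, Timed.lt, op, count]
  ring

/-- The list of the positions of an instance. -/
def positionList (I : Reallocation n K T) : List ℝ :=
  List.ofFn I.x0 ++ (List.ofFn fun t => List.ofFn (I.agent t)).flatten

theorem length_positionList (I : Reallocation n K T) : (positionList I).length = K + T * n := by
  simp [positionList, Function.comp_def, List.map_ofFn, List.ofFn_const]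

theorem mem_positionList (I : Reallocation n K T) (x : ℝ) :
    x ∈ positionList I ↔ x ∈ I.positions := by
  simp [positionList, Reallocation.positions, List.mem_ofFn]

theorem buildPath_edges_add_one_le (I : Reallocation n K T) [NeZero K] :
    (buildPath I).val.edges + 1 ≤ K + T * n := by
  have h : (buildPath I).val.edges = (sortDistinct (positionList I)).val.length - 1 := rfl
  have h1 := length_sortDistinct_le (positionList I)
  rw [length_positionList] at h1
  -- With an empty list the truncated `length - 1` would still give one node; `K ≥ 1` rules this
  -- out.
  have := NeZero.pos K
  omega

theorem isDiscretizationOf_buildPath [NeZero K] (I : Reallocation n K T) :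
    (buildPath I).val.IsDiscretizationOf I := by
  set l := (sortDistinct (positionList I)).val with hl
  have hlen : l.length - 1 + 1 = l.length := by
    have h : I.x0 0 ∈ l :=
      (mem_sortDistinct _ _).2 ((mem_positionList I _).2 (Or.inl ⟨0, rfl⟩))
    have := List.length_pos_of_mem h
    omega
  have hget : ∀ j : Fin (l.length - 1 + 1), l.getD j 0 = l[(j : ℕ)]'(j.2.trans_eq hlen) := fun j =>
    List.getD_eq_getElem _ _ _
  have hmono : StrictMono (buildPath I).val.node := by
    change StrictMono fun j : Fin (l.length - 1 + 1) => l.getD j 0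
    intro i j hij
    simp only [hget]
    exact List.pairwise_iff_getElem.1 (pairwise_sortDistinct _) _ _ _ _ hij
  have hrange : Set.range (buildPath I).val.node = I.positions := by
    change (Set.range fun j : Fin (l.length - 1 + 1) => l.getD j 0) = _
    ext x
    rw [← mem_positionList, ← mem_sortDistinct, ← hl, List.mem_iff_getElem]
    constructor
    · rintro ⟨j, rfl⟩
      exact ⟨j, j.2.trans_eq hlen, (hget j).symm⟩
    · rintro ⟨j, hj, rfl⟩
      exact ⟨⟨j, hj.trans_eq hlen.symm⟩, hget _⟩
  refine ⟨hmono, hrange, fun t i => ?_, fun k => ?_⟩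
  · obtain ⟨j, hj⟩ : I.agent t i ∈ Set.range (buildPath I).val.node := by
      rw [hrange]; exact Or.inr ⟨t, i, rfl⟩
    have h : (buildPath I).val.loc t i = (findIndex (buildPath I).val.node (I.agent t i)).val := rfl
    rw [h, ← hj, val_findIndex hmono]
  · obtain ⟨j, hj⟩ : I.x0 k ∈ Set.range (buildPath I).val.node := by
      rw [hrange]; exact Or.inl ⟨k, rfl⟩
    have h : (buildPath I).val.start k = (findIndex (buildPath I).val.node (I.x0 k)).val := rfl
    rw [h, ← hj, val_findIndex hmono]

theorem val_buildDist (D : Discretized n K T) : (buildDist D).val = D.d := by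
  funext j l
  by_cases h : D.node l < D.node j
  · simp [buildDist, fill, Timed.lt, Timed.sub, op, Bind.bind, h, Discretized.d,
      abs_of_pos (sub_pos.2 h)]
  · simp [buildDist, fill, Timed.lt, Timed.sub, op, Bind.bind, h, Discretized.d,
      abs_of_nonpos (sub_nonpos.2 (not_lt.1 h))]

theorem val_buildLP (D : Discretized n K T) : (buildLP D D.d).val = D.relaxation := rfl

/-- Breaking ties by index is the lexicographic order on pairs of position and index. It is linear,
which makes the ranks distinct. -/
theorem facilityRank_comparison (I : Reallocation n K T) (k k' : Fin K) :
    ((do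
      if ← Timed.lt (I.x0 k') (I.x0 k) then pure true
      else if ← Timed.lt (I.x0 k) (I.x0 k') then pure false
      else op (decide (k' < k)) : Timed Bool).val = true ↔
      toLex (I.x0 k', k') < toLex (I.x0 k, k)) := by
  rw [Prod.Lex.toLex_lt_toLex]
  by_cases h1 : I.x0 k' < I.x0 k
  · simp [Timed.lt, op, Bind.bind, Pure.pure, h1]
  · by_cases h2 : I.x0 k < I.x0 k'
    · simp [Timed.lt, op, Bind.bind, Pure.pure, h1, h2, h2.ne']
    · simp [Timed.lt, op, Bind.bind, le_antisymm (not_lt.1 h2) (not_lt.1 h1)]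

theorem val_facilityRank (I : Reallocation n K T) (k : Fin K) :
    (facilityRank I k).val = #{k' | toLex (I.x0 k', k') < toLex (I.x0 k, k)} := by
  simp only [← facilityRank_comparison I k]
  rfl

/-- The ranks number the facilities from left to right. -/
theorem exists_perm_facilityRank (I : Reallocation n K T) : ∃ σ : Equiv.Perm (Fin K),
    Monotone (I.x0 ∘ σ) ∧ ∀ m, (facilityRank I (σ m)).val = m := by
  have hlt : ∀ k k', toLex (I.x0 k', k') < toLex (I.x0 k, k) →
      (facilityRank I k').val < (facilityRank I k).val := by
    intro k k' h
    rw [val_facilityRank, val_facilityRank]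
    refine card_lt_card ⟨fun i hi => ?_, fun hsub => ?_⟩
    · simp only [mem_filter, mem_univ, true_and] at hi ⊢
      exact hi.trans h
    · have := hsub (x := k') (by simpa using h)
      simp at this
  have hK : ∀ k, (facilityRank I k).val < K := by
    intro k
    rw [val_facilityRank]
    refine lt_of_lt_of_eq (card_lt_univ_of_notMem (x := k) (by simp)) (Fintype.card_fin K)
  have hinj : Function.Injective fun k => (⟨_, hK k⟩ : Fin K) := by
    intro k k' h
    have h : (facilityRank I k).val = (facilityRank I k').val := by simpa using h
    rcases lt_trichotomy (toLex (I.x0 k', k')) (toLex (I.x0 k, k)) with h1 | h1 | h1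
    · exact absurd h (hlt _ _ h1).ne'
    · exact (Prod.ext_iff.1 (toLex.injective h1)).2.symm
    · exact absurd h (hlt _ _ h1).ne
  set τ : Equiv.Perm (Fin K) := Equiv.ofBijective _ (Finite.injective_iff_bijective.1 hinj)
  have hτ : ∀ k, (τ k : ℕ) = (facilityRank I k).val := fun k => rfl
  have hσ : ∀ m, (facilityRank I (τ.symm m)).val = m := fun m => by simp [← hτ]
  refine ⟨τ.symm, fun m m' hm => ?_, hσ⟩
  by_contra! h
  have := hlt (τ.symm m) (τ.symm m') (Prod.Lex.toLex_lt_toLex.2 (Or.inl h))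
  rw [hσ, hσ] at this
  exact this.not_ge hm

theorem firstExceeding_cons (r a : ℝ) (l : List ℝ) (s : ℝ) (j : ℕ) :
    firstExceeding r (a :: l) s j = if r < s + a then ⟨j, 2⟩ else
      ⟨(firstExceeding r l (s + a) (j + 1)).val,
        (firstExceeding r l (s + a) (j + 1)).steps + 3⟩ := by
  by_cases h : r < s + a
  · simp [firstExceeding, Timed.lt, Timed.add, op, Bind.bind, Pure.pure, h]
  · simp [firstExceeding, Timed.lt, Timed.add, op, Bind.bind, h]
    ring

theorem steps_firstExceeding_le (r : ℝ) (l : List ℝ) (s : ℝ) (j : ℕ) :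
    (firstExceeding r l s j).steps ≤ 3 * l.length := by
  induction l generalizing s j with
  | nil => simp [firstExceeding, Pure.pure]
  | cons a l ih =>
    rw [firstExceeding_cons, List.length_cons]
    have := ih (s + a) (j + 1)
    split_ifs <;> dsimp only <;> omega

/-- The loop invariant is `s ≤ r`; the bound on the total ensures that the walk stops before the
list ends. -/
theorem val_firstExceeding (r : ℝ) (l : List ℝ) (s : ℝ) (j : ℕ) (hs : s ≤ r)
    (hr : r < s + l.sum) : ∃ i < l.length, (firstExceeding r l s j).val = j + i ∧
      s + (l.take i).sum ≤ r ∧ r < s + (l.take (i + 1)).sum := by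
  induction l generalizing s j with
  | nil => simp at hr; linarith
  | cons a l ih =>
    rw [firstExceeding_cons]
    split_ifs with h
    · exact ⟨0, by simp, rfl, by simpa using hs, by simpa using h⟩
    · rw [List.sum_cons, ← add_assoc] at hr
      obtain ⟨i, hi, hval, h1, h2⟩ := ih (s + a) (j + 1) (not_lt.1 h) hr
      refine ⟨i + 1, by simpa using hi, ?_, ?_, ?_⟩
      · dsimp only
        rw [hval]
        ring
      · simpa [add_assoc] using h1
      · simpa [add_assoc] using h2

theorem isRounding_roundSolution {D : Discretized n K T} (I : Reallocation n K T)
    {z : FracSol n K T D.edges} (hz : z.IsFeasible D) :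
    z.IsRounding I D (roundSolution I D z).val := by
  obtain ⟨σ, hσ, hrank⟩ := exists_perm_facilityRank I
  refine ⟨σ, hσ, fun t m => ?_⟩
  have hval : (roundSolution I D z).val t (σ m) = D.node (Fin.ofNat (D.edges + 1)
      (firstExceeding ((facilityRank I (σ m)).val : ℝ) (List.ofFn (z.c t)) 0 0).val) := rfl
  obtain ⟨i, hi, hiv, h1, h2⟩ := val_firstExceeding (m : ℝ) (List.ofFn (z.c t)) 0 0
    (Nat.cast_nonneg _) (by
      rw [List.sum_ofFn, hz.sum_c, zero_add]
      exact_mod_cast m.2)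
  rw [List.length_ofFn] at hi
  rw [hval, hrank, hiv, zero_add]
  have hnode : Fin.ofNat (D.edges + 1) i = ⟨i, hi⟩ := Fin.ext (Nat.mod_eq_of_lt hi)
  refine ⟨_, ?_, rfl⟩
  rw [hnode]
  rw [List.sum_take_ofFn, zero_add] at h1 h2
  constructor
  · convert h1 using 2
    ext; simp [Fin.lt_def]
  · convert h2 using 2
    ext; simp [Fin.le_def]

/-! ### The number of steps -/

theorem steps_buildPath_le [NeZero K] (I : Reallocation n K T) {ν : ℕ} (hν : K + T * n ≤ ν) :
    (buildPath I).steps ≤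
      ν * (3 * ν) + 1 + (ν * 2 + (T * (n * (3 * ν + 2) + 1) + K * (3 * ν + 2))) := by
  have hN : (buildPath I).val.edges + 1 ≤ ν := (buildPath_edges_add_one_le I).trans hν
  have h1 : (sortDistinct (positionList I)).steps ≤ ν * (3 * ν) + 1 := by
    have := steps_sortDistinct_le (positionList I)
    rw [length_positionList] at this
    refine this.trans ?_
    gcongr
  have hidx : ∀ p, (findIndex (buildPath I).val.node p).steps ≤ 3 * ν + 1 := by
    intro p
    rw [steps_findIndex]
    omega
  have h2 : (fill fun j : (buildPath I).val.V => op ((buildPath I).val.node j)).steps ≤ ν * 2 := by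
    refine (steps_fill_le _ (b := 1) fun j => le_rfl).trans ?_
    rw [Fintype.card_fin]
    gcongr
  have h3 : (fill fun t => fill fun i =>
      findIndex (buildPath I).val.node (I.agent t i)).steps ≤ T * (n * (3 * ν + 2) + 1) := by
    refine (steps_fill_le _ fun t => steps_fill_le _ fun i => hidx _).trans ?_
    simp
  have h4 : (fill fun k => findIndex (buildPath I).val.node (I.x0 k)).steps ≤
      K * (3 * ν + 2) := by
    refine (steps_fill_le _ fun k => hidx _).trans ?_
    simp
  -- The step count of the nested binds unfolds definitionally to this sum.
  exact Nat.add_le_add h1 (Nat.add_le_add h2 (Nat.add_le_add h3 h4))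

theorem steps_buildDist_le (D : Discretized n K T) {ν : ℕ} (hν : D.edges + 1 ≤ ν) :
    (buildDist D).steps ≤ ν * (ν * 3 + 1) := by
  refine (steps_fill_le _ (b := ν * 3) fun j => ?_).trans ?_
  · refine (steps_fill_le _ (b := 2) fun l => ?_).trans ?_
    · rw [Timed.steps_bind]
      split_ifs <;> exact le_rfl
    · rw [Fintype.card_fin]
      gcongr
  · rw [Fintype.card_fin]
    gcongr

theorem steps_buildLP_le (D : Discretized n K T) (d : D.V → D.V → ℝ) {a b : ℕ}
    (ha : Fintype.card (Var n K T D.edges) ≤ a) (hb : Fintype.card (Row n K T D.edges) ≤ b) :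
    (buildLP D d).steps ≤ a * 2 + (b * (a * 2 + 1) + (b * 2 + b * 2)) := by
  have h1 : (fill fun v => op (Var.obj d D.loc v)).steps ≤ a * 2 :=
    (steps_fill_le _ (b := 1) fun j => le_rfl).trans (by gcongr)
  have h2 : (fill fun r : Row n K T D.edges => fill fun v => op (Row.coef d r v)).steps ≤
      b * (a * 2 + 1) :=
    (steps_fill_le _ (b := a * 2) fun r =>
      (steps_fill_le _ (b := 1) fun j => le_rfl).trans (by gcongr)).trans (by gcongr)
  have h3 : (fill fun r : Row n K T D.edges => op (Row.isEq r)).steps ≤ b * 2 :=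
    (steps_fill_le _ (b := 1) fun j => le_rfl).trans (by gcongr)
  have h4 : (fill fun r : Row n K T D.edges => op (Row.rhs D.start r)).steps ≤ b * 2 :=
    (steps_fill_le _ (b := 1) fun j => le_rfl).trans (by gcongr)
  exact Nat.add_le_add h1 (Nat.add_le_add h2 (Nat.add_le_add h3 h4))

theorem steps_facilityRank_le (I : Reallocation n K T) (k : Fin K) :
    (facilityRank I k).steps ≤ K * 4 + K := by
  refine Nat.add_le_add ((steps_fill_le _ (b := 3) fun k' => ?_).trans ?_) ?_
  · rw [Timed.steps_bind]
    split_ifs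
    · exact Nat.le_of_ble_eq_true rfl
    · rw [Timed.steps_bind]
      split_ifs
      · exact Nat.le_of_ble_eq_true rfl
      · exact le_rfl
  · rw [Fintype.card_fin]
  · exact (Fintype.card_fin K).le

theorem steps_roundSolution_le (I : Reallocation n K T) (D : Discretized n K T)
    (z : FracSol n K T D.edges) {ν : ℕ} (hν : D.edges + 1 ≤ ν) :
    (roundSolution I D z).steps ≤
      K * (K * 4 + K + 1) + T * (K * (ν * 2 + (3 * ν + 1) + 1) + 1) := by
  refine Nat.add_le_add ((steps_fill_le _ (steps_facilityRank_le I)).trans ?_) ?_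
  · rw [Fintype.card_fin]
  · refine (steps_fill_le _ (b := K * (ν * 2 + (3 * ν + 1) + 1)) fun t => ?_).trans ?_
    · refine (steps_fill_le _ (b := ν * 2 + (3 * ν + 1)) fun k => ?_).trans ?_
      · refine Nat.add_le_add ((steps_fill_le _ (b := 1) fun j => le_rfl).trans ?_)
          (Nat.add_le_add ((steps_firstExceeding_le _ _ _ _).trans ?_) le_rfl)
        · rw [Fintype.card_fin]
          gcongr
        · rw [List.length_ofFn]
          gcongr
      · rw [Fintype.card_fin]
    · rw [Fintype.card_fin]

/-! ### Encoding lengths -/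

theorem bitLength_ratCast (q : ℚ) : bitLength (q : ℝ) = q.num.natAbs.size + q.den.size + 1 := by
  have h : ∃ q' : ℚ, (q' : ℝ) = q := ⟨q, rfl⟩
  rw [bitLength, dif_pos h, Rat.cast_injective h.choose_spec]

theorem bitLength_zero : bitLength 0 = 2 := by
  have := bitLength_ratCast 0
  simpa using this

theorem bitLength_one : bitLength 1 = 3 := by
  have := bitLength_ratCast 1
  simpa using this

theorem bitLength_neg_one : bitLength (-1) = 3 := by
  have := bitLength_ratCast (-1)
  simpa using this

/-- In lowest terms the denominator divides the product of the denominators, and the numerator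
divides the cross difference. Each has at most the two lengths together as its size, whence the
factor `2`. -/
theorem bitLength_sub_le {a b : ℝ} (ha : IsRat a) (hb : IsRat b) :
    bitLength (a - b) ≤ 2 * (bitLength a + bitLength b) := by
  obtain ⟨q, rfl⟩ := ha
  obtain ⟨r, rfl⟩ := hb
  have hq := bitLength_ratCast q
  have hr := bitLength_ratCast r
  rw [← Rat.cast_sub, bitLength_ratCast]
  have hsize : ∀ m k : ℕ, m * k < 2 ^ (m.size + k.size) := fun m k => by
    rw [pow_add]
    exact Nat.mul_lt_mul'' m.lt_size_self k.lt_size_self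
  have hden0 : (q.den * r.den : ℤ) ≠ 0 := by
    exact_mod_cast mul_ne_zero q.den_nz r.den_nz
  have heq : q - r = Rat.divInt (q.num * r.den - r.num * q.den) (q.den * r.den) := by
    have hq0 : (q.den : ℚ) ≠ 0 := by exact_mod_cast q.den_nz
    have hr0 : (r.den : ℚ) ≠ 0 := by exact_mod_cast r.den_nz
    conv_lhs => rw [← Rat.num_div_den q, ← Rat.num_div_den r, div_sub_div _ _ hq0 hr0]
    rw [Rat.divInt_eq_div]
    push_cast
    ring
  have h1 : (q - r).den.size ≤ bitLength (q : ℝ) + bitLength (r : ℝ) := by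
    rw [Nat.size_le]
    have hdvd : (q - r).den ∣ q.den * r.den := by
      have := Rat.den_dvd (q.num * r.den - r.num * q.den) (q.den * r.den)
      rw [← heq] at this
      exact_mod_cast this
    refine (Nat.le_of_dvd (Nat.mul_pos q.den_pos r.den_pos) hdvd).trans_lt
      ((hsize _ _).trans_le (Nat.pow_le_pow_right two_pos (by omega)))
  have h2 : (q - r).num.natAbs.size + 1 ≤ bitLength (q : ℝ) + bitLength (r : ℝ) := by
    have hle : (q - r).num.natAbs ≤ q.num.natAbs * r.den + r.num.natAbs * q.den := by
      by_cases h0 : q.num * r.den - r.num * q.den = 0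
      · rw [heq, h0]
        simp
      · have hdvd := Rat.num_dvd (q.num * r.den - r.num * q.den) hden0
        rw [← heq] at hdvd
        have := Nat.le_of_dvd (Int.natAbs_pos.2 h0) (Int.natAbs_dvd_natAbs.2 hdvd)
        refine this.trans ((Int.natAbs_sub_le _ _).trans ?_)
        rw [Int.natAbs_mul, Int.natAbs_mul, Int.natAbs_natCast, Int.natAbs_natCast]
    have hlt : (q - r).num.natAbs < 2 ^ (bitLength (q : ℝ) + bitLength (r : ℝ) - 1) := by
      refine hle.trans_lt ?_
      -- The `+ 1` in both bit lengths leaves room: each cross product is below `2` to the sum minus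
      -- `2`, so both together stay below `2` to the sum minus `1`.
      have e : bitLength (q : ℝ) + bitLength (r : ℝ) - 1 =
        bitLength (q : ℝ) + bitLength (r : ℝ) - 2 + 1 := by omega
      rw [e, pow_succ, mul_two]
      refine Nat.add_lt_add ((hsize _ _).trans_le (Nat.pow_le_pow_right two_pos (by omega)))
        ((hsize _ _).trans_le (Nat.pow_le_pow_right two_pos (by omega)))
    have := Nat.size_le.2 hlt
    omega
  omega

theorem IsRat.sub {a b : ℝ} (ha : IsRat a) (hb : IsRat b) : IsRat (a - b) := by
  obtain ⟨q, rfl⟩ := ha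
  obtain ⟨r, rfl⟩ := hb
  exact ⟨q - r, Rat.cast_sub q r⟩

namespace Reallocation

variable {I : Reallocation n K T}

theorem IsRational.isRat (hI : I.IsRational) {p : ℝ} (hp : p ∈ I.positions) : IsRat p := by
  rcases hp with ⟨k, rfl⟩ | ⟨t, i, rfl⟩
  · exact hI.1 k
  · exact hI.2 t i

theorem bitLength_le_bitSize {p : ℝ} (hp : p ∈ I.positions) : bitLength p ≤ I.bitSize := by
  rw [Reallocation.bitSize]
  rcases hp with ⟨k, rfl⟩ | ⟨t, i, rfl⟩
  · have := single_le_sum_of_canonicallyOrdered (f := fun k => bitLength (I.x0 k)) (mem_univ k)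
    omega
  · have h1 := single_le_sum_of_canonicallyOrdered (f := fun i => bitLength (I.agent t i))
      (mem_univ i)
    have h2 := single_le_sum_of_canonicallyOrdered
      (f := fun t => ∑ i, bitLength (I.agent t i)) (mem_univ t)
    omega

end Reallocation

/-- The numbers that occur in the relaxation. -/
inductive IsEntry (D : Discretized n K T) : ℝ → Prop
  | zero : IsEntry D 0
  | one : IsEntry D 1
  | neg_one : IsEntry D (-1)
  | sub (j l : D.V) : IsEntry D (D.node j - D.node l)

namespace IsEntry

variable {D : Discretized n K T}

theorem d (j l : D.V) : IsEntry D (D.d j l) := by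
  rw [Discretized.d]
  rcases abs_choice (D.node j - D.node l) with h | h
  · rw [h]; exact sub j l
  · rw [h, neg_sub]; exact sub l j

theorem neg_d (j l : D.V) : IsEntry D (-D.d j l) := by
  rw [Discretized.d]
  rcases abs_choice (D.node j - D.node l) with h | h
  · rw [h, neg_sub]; exact sub l j
  · rw [h, neg_neg]; exact sub j l

theorem ite_zero {p : Prop} [Decidable p] {a : ℝ} (ha : IsEntry D a) :
    IsEntry D (if p then a else 0) := by
  split_ifs
  · exact ha
  · exact zero

theorem isRat {I : Reallocation n K T} (hD : D.IsDiscretizationOf I) (hI : I.IsRational) {a : ℝ}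
    (ha : IsEntry D a) : IsRat a := by
  cases ha with
  | zero => exact ⟨0, Rat.cast_zero⟩
  | one => exact ⟨1, Rat.cast_one⟩
  | neg_one => exact ⟨-1, by simp⟩
  | sub j l =>
    exact (hI.isRat (hD.range_eq ▸ ⟨j, rfl⟩)).sub (hI.isRat (hD.range_eq ▸ ⟨l, rfl⟩))

/-- A difference costs twice the lengths of two nodes, each at most `I.bitSize`; the constants need
at most `3` bits. -/
theorem bitLength_le [NeZero K] {I : Reallocation n K T} (hD : D.IsDiscretizationOf I)
    (hI : I.IsRational) {a : ℝ} (ha : IsEntry D a) : bitLength a ≤ 4 * I.bitSize := by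
  have hpos : 1 ≤ I.bitSize := by
    have := NeZero.pos K
    rw [Reallocation.bitSize]
    omega
  have hnode : ∀ j, D.node j ∈ I.positions := fun j => hD.range_eq ▸ ⟨j, rfl⟩
  cases ha with
  | zero => rw [bitLength_zero]; omega
  | one => rw [bitLength_one]; omega
  | neg_one => rw [bitLength_neg_one]; omega
  | sub j l =>
    have h := bitLength_sub_le (hI.isRat (hnode j)) (hI.isRat (hnode l))
    have h1 := Reallocation.bitLength_le_bitSize (hnode j)
    have h2 := Reallocation.bitLength_le_bitSize (hnode l)
    omega

end IsEntry

theorem isEntry_obj (D : Discretized n K T) (v : Var n K T D.edges) :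
    IsEntry D (D.relaxation.obj v) := by
  rcases v with (_ | _ | _) | _ | _
  · exact .d _ _
  all_goals first | exact .zero | exact .one

theorem isEntry_coef (D : Discretized n K T) (r : Row n K T D.edges) (v : Var n K T D.edges) :
    IsEntry D (D.relaxation.coef r v) := by
  change IsEntry D (Row.coef D.d r v)
  unfold Row.coef
  split <;> first
    | exact .zero
    | exact .ite_zero .one
    | exact .ite_zero .neg_one
    | exact .ite_zero (.neg_d _ _)

theorem isEntry_rhs (D : Discretized n K T) (r : Row n K T D.edges) :
    IsEntry D (D.relaxation.rhs r) := by
  change IsEntry D (Row.rhs D.start r)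
  unfold Row.rhs
  split <;> first
    | exact .zero
    | exact .one
    | exact .ite_zero .one

theorem relaxation_isRational {D : Discretized n K T} {I : Reallocation n K T}
    (hD : D.IsDiscretizationOf I) (hI : I.IsRational) : D.relaxation.IsRational :=
  ⟨fun v => (isEntry_obj D v).isRat hD hI, fun r v => (isEntry_coef D r v).isRat hD hI,
    fun r => (isEntry_rhs D r).isRat hD hI⟩

theorem bitSize_relaxation_le [NeZero K] {D : Discretized n K T} {I : Reallocation n K T}
    (hD : D.IsDiscretizationOf I) (hI : I.IsRational) {a b : ℕ}
    (ha : Fintype.card (Var n K T D.edges) ≤ a) (hb : Fintype.card (Row n K T D.edges) ≤ b) :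
    D.relaxation.bitSize ≤ a + b + a * (4 * I.bitSize) + b * (a * (4 * I.bitSize)) +
      b * (4 * I.bitSize) := by
  have hsum : ∀ {ι : Type} [Fintype ι] (g : ι → ℕ) {c B : ℕ}, Fintype.card ι ≤ c →
      (∀ i, g i ≤ B) → ∑ i, g i ≤ c * B := by
    intro ι _ g c B hc hB
    refine (sum_le_card_nsmul univ g B fun i _ => hB i).trans ?_
    rw [smul_eq_mul, card_univ]
    gcongr
  refine Nat.add_le_add (Nat.add_le_add (Nat.add_le_add (Nat.add_le_add ha hb) ?_) ?_) ?_
  · exact hsum _ ha fun v => (isEntry_obj D v).bitLength_le hD hI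
  · exact hsum _ hb fun r => hsum _ ha fun v => (isEntry_coef D r v).bitLength_le hD hI
  · exact hsum _ hb fun r => (isEntry_rhs D r).bitLength_le hD hI

/-! ### Polynomial bounds -/

open Polynomial

theorem _root_.Polynomial.eval_le_eval_of_le (p : ℕ[X]) {a b : ℕ} (h : a ≤ b) :
    p.eval a ≤ p.eval b := by
  rw [eval_eq_sum, eval_eq_sum]
  exact sum_le_sum fun i _ => Nat.mul_le_mul le_rfl (Nat.pow_le_pow_left h i)

/-- A bound for the number of nodes. -/
def nodesBound : ℕ[X] := X + X * X

/-- This and the next polynomials copy the formulas for the dimensions and step counts with `n`,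
`K`, `T` replaced by `X`, so that `gcongr` can compare them term by term. -/
def binVarBound : ℕ[X] :=
  X * (X * nodesBound) + (X * (X * nodesBound) + X * (X * (nodesBound * nodesBound)))

def varBound : ℕ[X] := binVarBound + (X * nodesBound + X * X)

def rowBound : ℕ[X] :=
  X * X + (X * (X * nodesBound) + (X * nodesBound + (X * X + (X * X + (X * (X * nodesBound) +
    (X * (X * nodesBound) + (binVarBound + binVarBound)))))))

def stepsBound : ℕ[X] :=
  (nodesBound * (3 * nodesBound) + 1 + (nodesBound * 2 +
    (X * (X * (3 * nodesBound + 2) + 1) + X * (3 * nodesBound + 2)))) +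
  (nodesBound * (nodesBound * 3 + 1) +
  ((varBound * 2 + (rowBound * (varBound * 2 + 1) + (rowBound * 2 + rowBound * 2))) +
  (X * (X * 4 + X + 1) + X * (X * (nodesBound * 2 + (3 * nodesBound + 1) + 1) + 1))))

def bitsBound : ℕ[X] :=
  varBound + rowBound + varBound * (4 * X) + rowBound * (varBound * (4 * X)) + rowBound * (4 * X)

section Bounds

variable {N s : ℕ}

theorem card_binVar_le (hs : n + K + T ≤ s) (hN : N + 1 ≤ nodesBound.eval s) :
    Fintype.card (BinVar n K T N) ≤ binVarBound.eval s := by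
  have hn : n ≤ s := by omega
  have hK : K ≤ s := by omega
  have hT : T ≤ s := by omega
  rw [card_binVar]
  simp only [binVarBound, eval_add, eval_mul, eval_X]
  gcongr

theorem card_var_le (hs : n + K + T ≤ s) (hN : N + 1 ≤ nodesBound.eval s) :
    Fintype.card (Var n K T N) ≤ varBound.eval s := by
  have hK : K ≤ s := by omega
  have hT : T ≤ s := by omega
  have := card_binVar_le hs hN
  rw [card_var]
  simp only [varBound, eval_add, eval_mul, eval_X]
  gcongr

theorem card_row_le (hs : n + K + T ≤ s) (hN : N + 1 ≤ nodesBound.eval s) :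
    Fintype.card (Row n K T N) ≤ rowBound.eval s := by
  have hn : n ≤ s := by omega
  have hK : K ≤ s := by omega
  have hT : T ≤ s := by omega
  have := card_binVar_le hs hN
  rw [card_row]
  simp only [rowBound, eval_add, eval_mul, eval_X]
  gcongr

end Bounds

/-! ### The algorithm as a whole -/

theorem val_lpRounding (A : LPSolver) (I : Reallocation n K T) : (lpRounding A I).val =
    { path := (buildPath I).val
      frac := FracSol.ofVector (A.solve (buildPath I).val.relaxation)
      sol := (roundSolution I (buildPath I).val
        (FracSol.ofVector (A.solve (buildPath I).val.relaxation))).val } := by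
  rw [← val_buildLP, ← val_buildDist]
  rfl

theorem steps_lpRounding (A : LPSolver) (I : Reallocation n K T) : (lpRounding A I).steps =
    (buildPath I).steps + ((buildDist (buildPath I).val).steps +
      ((buildLP (buildPath I).val (buildPath I).val.d).steps +
        (A.time (buildPath I).val.relaxation + (roundSolution I (buildPath I).val
          (FracSol.ofVector (A.solve (buildPath I).val.relaxation))).steps))) := by
  rw [← val_buildLP, ← val_buildDist]
  rfl

theorem le_eval_nodesBound (n K T : ℕ) :
    K + T * n ≤ nodesBound.eval (n + K + T) := by
  simp only [nodesBound, eval_add, eval_mul, eval_X]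
  nlinarith

theorem steps_lpRounding_le [NeZero K] (A : LPSolver) (I : Reallocation n K T) :
    (lpRounding A I).steps ≤
      stepsBound.eval (n + K + T) + A.time (buildPath I).val.relaxation := by
  have hν := le_eval_nodesBound n K T
  have hN := (buildPath_edges_add_one_le I).trans hν
  have h1 := steps_buildPath_le I hν
  have h2 := steps_buildDist_le (buildPath I).val hN
  have h3 := steps_buildLP_le (buildPath I).val (buildPath I).val.d (card_var_le le_rfl hN)
    (card_row_le le_rfl hN)
  have h4 := steps_roundSolution_le I (buildPath I).val
    (FracSol.ofVector (A.solve (buildPath I).val.relaxation)) hN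
  rw [steps_lpRounding]
  simp only [stepsBound, eval_add, eval_mul, eval_X, eval_ofNat, eval_one]
  set s := n + K + T
  have hn : n ≤ s := by omega
  have hK : K ≤ s := by omega
  have hT : T ≤ s := by omega
  refine le_trans (Nat.add_le_add h1 (Nat.add_le_add h2 (Nat.add_le_add h3
    (Nat.add_le_add le_rfl h4)))) ?_
  generalize A.time (buildPath I).val.relaxation = τ
  rw [add_left_comm _ τ, add_left_comm _ τ, add_left_comm _ τ, add_comm τ]
  gcongr

end FacilityReallocation

end

theorem mainTheorem1 :
    -- rounding an optimal fractional solution costs nothing, and gives an optimal solution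
    (∀ (n K T : ℕ) [NeZero K] (I : Reallocation n K T) (D : Discretized n K T),
      D.IsDiscretizationOf I →
        (∃ z : FracSol n K T D.edges, z.IsOptimal D) ∧
        ∀ z : FracSol n K T D.edges, z.IsOptimal D →
          (∀ t m, ∃! j : D.V, z.IsRoundingNode D t m j) ∧
          ∀ x : Fin T → Fin K → ℝ, z.IsRounding I D x →
            I.cost x = z.objective D ∧ ∀ y : Fin T → Fin K → ℝ, I.cost x ≤ I.cost y) ∧
    ∃ p : Polynomial ℕ,
      -- the algorithm, with any exact solver, on real instances
      (∀ (A : LPSolver) (n K T : ℕ) [NeZero K] (I : Reallocation n K T),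
        let D := (lpRounding A I).val.path
        let z := (lpRounding A I).val.frac
        let x := (lpRounding A I).val.sol
        D.IsDiscretizationOf I ∧ z.IsOptimal D ∧ z.IsRounding I D x ∧
        I.cost x = z.objective D ∧ (∀ y : Fin T → Fin K → ℝ, I.cost x ≤ I.cost y) ∧
        Fintype.card (Var n K T D.edges) ≤ p.eval (n + K + T) ∧
        Fintype.card (Row n K T D.edges) ≤ p.eval (n + K + T) ∧
        (lpRounding A I).steps ≤ p.eval (n + K + T) + A.time D.relaxation) ∧
      -- polynomial running time in the encoding length, on rational instances
      (∀ (A : LPSolver) (τ : Polynomial ℕ), A.RunsInTime τ →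
        ∀ (n K T : ℕ) [NeZero K] (I : Reallocation n K T), I.IsRational →
          (lpRounding A I).steps ≤ (p + τ.comp p).eval I.bitSize) := by
  refine ⟨fun n K T _ I D hD => ⟨exists_isOptimal hD, fun z hz =>
    ⟨fun t m => existsUnique_isRoundingNode hz.1 t m, fun x hx => cost_of_isRounding hD hz hx⟩⟩,
    -- `bitsBound` contains `varBound + rowBound` and also bounds the encoding length of the LP, so
    -- one polynomial serves for the dimensions, the steps and the argument of `τ`.
    stepsBound + bitsBound, fun A n K T _ I => ?_, fun A τ hA n K T _ I hI => ?_⟩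
  · have hD := isDiscretizationOf_buildPath I
    have hz := isOptimal_solve A hD
    have hx := isRounding_roundSolution I hz.1
    have hN := (buildPath_edges_add_one_le I).trans (le_eval_nodesBound n K T)
    have hv := card_var_le le_rfl hN
    have hr := card_row_le le_rfl hN
    have hs := steps_lpRounding_le A I
    obtain ⟨h1, h2⟩ := cost_of_isRounding hD hz hx
    rw [val_lpRounding]
    simp only [bitsBound, Polynomial.eval_add]
    refine ⟨hD, hz, hx, h1, h2, ?_, ?_, ?_⟩ <;> omega
  · have hD := isDiscretizationOf_buildPath I
    have hσ : n + K + T ≤ I.bitSize := by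
      rw [Reallocation.bitSize]
      omega
    have hN := ((buildPath_edges_add_one_le I).trans (le_eval_nodesBound n K T)).trans
      (nodesBound.eval_le_eval_of_le hσ)
    have hL : (buildPath I).val.relaxation.bitSize ≤ bitsBound.eval I.bitSize := by
      simpa [bitsBound] using
        bitSize_relaxation_le hD hI (card_var_le hσ hN) (card_row_le hσ hN)
    have htime := (hA _ (relaxation_isRational hD hI)).trans (τ.eval_le_eval_of_le
      (hL.trans (Nat.le_add_left _ (stepsBound.eval I.bitSize))))
    have hsteps := (steps_lpRounding_le A I).trans
      (Nat.add_le_add (stepsBound.eval_le_eval_of_le hσ) htime)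
    rw [Polynomial.eval_add, Polynomial.eval_comp, Polynomial.eval_add]
    omega
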